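/- Let $\mathcal U$ be a Hopf $*$-algebra over $\mathbb C$ with comultiplication $\Delta(f)=f_{(1)}\otimes f_{(2)}$, counit $\varepsilon$ and antipode $S$ (so $S^{-1}=*\circ S\circ *$). Let $\mathcal B$ be a left $\mathcal U$-module $*$-algebra: a unital $*$-algebra with a left action $\triangleright$ of $\mathcal U$ such that $f\triangleright(xy)=(f_{(1)}\triangleright x)(f_{(2)}\triangleright y)$, $f\triangleright 1=\varepsilon(f)1$ and $(f\triangleright x)^*=S(f)^*\triangleright x^*$. Let $\sigma$ be an algebra automorphism of $\mathcal B$ with $\sigma(b)^*=\sigma^{-1}(b^*)$ and $\sigma(f\triangleright b)=S^2(f)\triangleright\sigma(b)$, and let $\lambda$ be an automorphism of $\mathcal B$ of the form $\lambda(b)=k\triangleright b$ with $k\in\mathcal U$ group-like ($\Delta(k)=k\otimes k$, $\varepsilon(k)=1$). *Equivariant K-theory.* For a matrix $X$ over $\mathcal B$ put $X^\dagger=\sigma(X)^*$. An invariant projection is a matrix $P\in M_m(\mathcal B)$ with $P^2=P=P^\dagger$ together with a $*$-representation $\rho^\circ$ of the opposite algebra $\mathcal U^\circ$ on $\mathbb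 C^m$ such that $\rho^\circ(S^{-1}(f_{(1)}))\,(S^{-2}(f_{(2)})\triangleright P)\,\rho^\circ(f_{(3)})=\varepsilon(f)P$ for all $f\in\mathcal U$. Invariant projections $P\in M_m(\mathcal B)$ and $Q\in M_{m'}(\mathcal B)$, with representations $\rho_1^\circ,\rho_2^\circ$, are Murray–von Neumann equivalent if there is $V\in M_{m'\times m}(\mathcal B)$ with $V^\dagger V=P$, $VV^\dagger=Q$ and $\pi_2^\circ(f)V=V\pi_1^\circ(f)$ for all $f$, where $\pi_i^\circ(f)\mathbf b=\rho_i^\circ(f_{(2)})(S^{-1}(f_{(1)})\triangleright\mathbf b)$ on column vectors $\mathbf b$. $K_0^{\mathcal U}(\mathcal B)$ is the Grothendieck group of the semigroup of equivalence classes with $[P]+[Q]=[P\oplus Q]$. *Twisted cyclic cohomology.* On elementary tensors $a_0\otimes\cdots\otimes a_n\in\mathcal B^{\otimes(n+1)}$ let $\tau_n^\lambda(a_0\otimes\cdots\otimes a_n)=\lambda(a_n)\otimes a_0\otimes\cdots\otimes a_{n-1}$, $s_n(a_0\otimes\cdots\otimes a_n)=1\otimes a_0\otimes\cdots\otimes a_n$,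 $$b_n^\lambda(a_0\otimes\cdots\otimes a_n)=\sum_{i=0}^{n-1}(-1)^i a_0\otimes\cdots\otimes a_ia_{i+1}\otimes\cdots\otimes a_n+(-1)^n\lambda(a_n)a_0\otimes a_1\otimes\cdots\otimes a_{n-1},$$ $$B_n^\lambda=(1-(-1)^{n+1}\tau^\lambda_{n+1})\,s_n\sum_{j=0}^n(-1)^{nj}(\tau^\lambda_n)^j .$$ These act on $C_n^\lambda=\mathcal B^{\otimes(n+1)}/\mathrm{im}(\mathrm{id}-(\tau_n^\lambda)^{n+1})$, and $\mathrm{HC}_\lambda^{N}(\mathcal B)$ is the $N$-th cohomology of the total complex of the $\mathbb C$-dual of the $(b,B)$-bicomplex formed by the $C_n^\lambda$; its $N$-cochains are tuples $(\psi_N,\psi_{N-2},\dots)$ with $\psi_m\in (C_m^\lambda)^*$. A twisted cyclic $N$-cocycle is an $(N+1)$-linear form $\Phi$ on $\mathcal B$ with $\Phi=(-1)^N\Phi\circ\tau_N^\lambda$ and $\Phi\circ b_{N+1}^\lambda=0$; it defines the class $[\Phi]=[(\Phi,0,\dots,0)]\in \mathrm{HC}_\lambda^{N}(\mathcal B)$.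 *Twisted Chern character.* For matrices $A_i=(a^i_{j,j'})\in M_m(\mathcal B)$ put $$\mathrm{Tr}_\lambda(A_0\otimes\cdots\otimes A_n)=\sum_{j_0,\dots,j_{n+1}}\rho^\circ(k)_{j_{n+1},j_0}\,a^0_{j_0,j_1}\otimes\cdots\otimes a^n_{j_n,j_{n+1}},$$ and for an invariant projection $P$ and $i\ge 0$ put $$c_{2i}(P)=(-1)^i\frac{(2i)!}{i!}\,\mathrm{Tr}_\lambda\Big(P^{\otimes(2i+1)}-\tfrac12\big(1\otimes P^{\otimes 2i}-P\otimes 1\otimes P^{\otimes(2i-1)}\big)\Big),$$ where the term with factor $\tfrac12$ is absent for $i=0$. **Statement.** For every $n\in\mathbb N_0$ there is a pairing $\langle\cdot,\cdot\rangle:\mathrm{HC}_\lambda^{2n}(\mathcal B)\times K_0^{\mathcal U}(\mathcal B)\to\mathbb C$, linear in the first and additive in the second variable, given by evaluating cocycles on the twisted Chern character: $$\langle[(\psi_{2n},\psi_{2n-2},\dots,\psi_0)],[P]\rangle=\sum_{i=0}^n\psi_{2i}(c_{2i}(P))$$ for every cocycle $(\psi_{2n},\dots,\psi_0)$ and every invariant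 projection $P$. For a twisted cyclic $2n$-cocycle $\Phi$ it takes the form $$\langle[\Phi],[P]\rangle=(-1)^n\frac{(2n)!}{n!}\,\Phi\big(\mathrm{Tr}_\lambda(P\otimes P\otimes\cdots\otimes P)\big).$$ -/

import Mathlib

open TensorProduct Coalgebra HopfAlgebra

noncomputable section

namespace TwistedChern

/-! ### Hopf *-algebras and module *-algebras -/

/-- Compatibility of the involution of a *-algebra `U` with a Hopf algebra structure on `U`:
the comultiplication and the counit are *-homomorphisms, so that `U` is a Hopf *-algebra. -/
class IsHopfStarAlgebra (U : Type*) [Ring U] [HopfAlgebra ℂ U] [StarRing U] [StarModule ℂ U] :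
    Prop where
  comul_star : ∀ f : U, comul (R := ℂ) (star f) = star (comul (R := ℂ) f)
  counit_star : ∀ f : U, counit (R := ℂ) (star f) = star (counit (R := ℂ) f)

/-- A unital *-algebra `B` as a left `U`-module *-algebra. The action is `f ▷ x = act f x`. -/
structure ModuleStarAlgebra (U B : Type*) [Ring U] [HopfAlgebra ℂ U] [StarRing U]
    [StarModule ℂ U] [Ring B] [Algebra ℂ B] [StarRing B] [StarModule ℂ B] where
  act : U →ₐ[ℂ] Module.End ℂ B
  /-- `f ▷ (x y) = (f₍₁₎ ▷ x) (f₍₂₎ ▷ y)` -/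
  act_mul : ∀ (f : U) (x y : B), act f (x * y) =
    LinearMap.mul' ℂ B
      (TensorProduct.map (act.toLinearMap.flip x) (act.toLinearMap.flip y) (comul (R := ℂ) f))
  act_one : ∀ f : U, act f 1 = counit (R := ℂ) f • (1 : B)
  star_act : ∀ (f : U) (x : B), star (act f x) = act (star (antipode ℂ f)) (star x)

section Hopf

variable {U : Type*} [Ring U] [HopfAlgebra ℂ U] [StarRing U] [StarModule ℂ U]

/-- The inverse `S⁻¹ = * ∘ S ∘ *` of the antipode of a Hopf *-algebra
(see `antipode_antipodeInv` and `antipodeInv_antipode`). -/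
def antipodeInv : U →ₗ[ℂ] U where
  toFun f := star (antipode ℂ (star f))
  map_add' f g := by simp
  map_smul' c f := by simp

theorem antipode_antipodeInv [IsHopfStarAlgebra U] (f : U) :
    antipode ℂ (antipodeInv f) = f := by
  have h1 : WithConv.toConv (antipode ℂ (A := U)) *
      WithConv.toConv (antipode ℂ (A := U) ∘ₗ antipodeInv) = 1 := by
    ext c
    have hc : c = star (star c) := (star_star c).symm
    have e := (ℛ ℂ (star c)).eq
    have e' : comul (R := ℂ) c = ∑ i ∈ (ℛ ℂ (star c)).index,
        star ((ℛ ℂ (star c)).left i) ⊗ₜ[ℂ] star ((ℛ ℂ (star c)).right i) := by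
      conv_lhs => rw [hc, IsHopfStarAlgebra.comul_star, ← e]
      simp [star_sum]
    have key := sum_mul_antipode_eq_algebraMap_counit (ℛ ℂ (star c))
    have key2 := congrArg (fun u => antipode ℂ (star u)) key
    simp only [star_sum, map_sum, star_mul, antipode_mul_antidistrib] at key2
    rw [LinearMap.convMul_apply, e']
    simp only [map_sum, TensorProduct.map_tmul, LinearMap.mul'_apply,
      LinearMap.comp_apply, antipodeInv, LinearMap.coe_mk, AddHom.coe_mk, star_star]
    rw [key2, IsHopfStarAlgebra.counit_star]
    simp [Algebra.algebraMap_eq_smul_one]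
  have h2 := left_inv_eq_right_inv (LinearMap.id_mul_antipode (R := ℂ) (C := U)) h1
  have h3 := congrArg (fun g : WithConv (U →ₗ[ℂ] U) => g f) h2
  simpa using h3.symm

theorem antipodeInv_antipode [IsHopfStarAlgebra U] (f : U) :
    antipodeInv (antipode ℂ f) = f := by
  have h := antipode_antipodeInv (star f)
  simp only [antipodeInv, LinearMap.coe_mk, AddHom.coe_mk, star_star] at h ⊢
  rw [h, star_star]

end Hopf

/-! ### Invariant projections and equivariant K-theory -/

section KTheory

variable {U B : Type*} [Ring U] [HopfAlgebra ℂ U] [StarRing U] [StarModule ℂ U]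
  [Ring B] [Algebra ℂ B] [StarRing B] [StarModule ℂ B]

/-- `X† = σ(X)*` for a matrix `X` over `B`. -/
def dagger (σ : B ≃ₐ[ℂ] B) {m n : ℕ} (X : Matrix (Fin m) (Fin n) B) : Matrix (Fin n) (Fin m) B :=
  (X.map σ).conjTranspose

/-- The matrix `ρ°(f)`, viewed as a matrix over `B`, as a linear function of `f`. -/
def repMatrix (R : Type*) [Ring R] [Algebra ℂ R] {m : ℕ}
    (ρ : Uᵐᵒᵖ →⋆ₐ[ℂ] Matrix (Fin m) (Fin m) ℂ) : U →ₗ[ℂ] Matrix (Fin m) (Fin m) R where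
  toFun f := (ρ (MulOpposite.op f)).map (algebraMap ℂ R)
  map_add' f g := by ext; simp
  map_smul' c f := by
    ext i j
    rw [MulOpposite.op_smul, map_smul]
    simp [Algebra.algebraMap_eq_smul_one, mul_smul]

/-- The entrywise action `f ▷ X` on matrices, as a linear function of `f`. -/
def actMatrix (M : ModuleStarAlgebra U B) {m n : ℕ} (X : Matrix (Fin m) (Fin n) B) :
    U →ₗ[ℂ] Matrix (Fin m) (Fin n) B where
  toFun f := X.map (M.act f)
  map_add' f g := by ext; simp
  map_smul' c f := by ext; simp

/-- The linear map on `U ⊗ U ⊗ U` with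
`f ⊗ (g ⊗ h) ↦ ρ°(S⁻¹(f)) (S⁻²(g) ▷ X) ρ°(h)`. -/
def adRTensor (M : ModuleStarAlgebra U B) {m : ℕ} (ρ : Uᵐᵒᵖ →⋆ₐ[ℂ] Matrix (Fin m) (Fin m) ℂ)
    (X : Matrix (Fin m) (Fin m) B) : U ⊗[ℂ] (U ⊗[ℂ] U) →ₗ[ℂ] Matrix (Fin m) (Fin m) B :=
  LinearMap.mul' ℂ (Matrix (Fin m) (Fin m) B) ∘ₗ
    TensorProduct.map (repMatrix B ρ ∘ₗ antipodeInv)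
      (LinearMap.mul' ℂ (Matrix (Fin m) (Fin m) B) ∘ₗ
        TensorProduct.map (actMatrix M X ∘ₗ antipodeInv ∘ₗ antipodeInv) (repMatrix B ρ))

/-- `ad°_R(f)(X) = ρ°(S⁻¹(f₍₁₎)) (S⁻²(f₍₂₎) ▷ X) ρ°(f₍₃₎)`. -/
def adR (M : ModuleStarAlgebra U B) {m : ℕ} (ρ : Uᵐᵒᵖ →⋆ₐ[ℂ] Matrix (Fin m) (Fin m) ℂ)
    (f : U) (X : Matrix (Fin m) (Fin m) B) : Matrix (Fin m) (Fin m) B :=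
  adRTensor M ρ X ((comul (R := ℂ)).lTensor U (comul (R := ℂ) f))

/-- The operator `π°(f)` on `ℂᵐ ⊗ B = Bᵐ`:
`π°(f) b = ρ°(f₍₂₎) (S⁻¹(f₍₁₎) ▷ b)`. -/
def piRep (M : ModuleStarAlgebra U B) {m : ℕ} (ρ : Uᵐᵒᵖ →⋆ₐ[ℂ] Matrix (Fin m) (Fin m) ℂ)
    (f : U) (b : Fin m → B) : Fin m → B :=
  TensorProduct.lift
    (LinearMap.mk₂ ℂ
      (fun g h : U => (repMatrix B ρ h).mulVec (fun i => M.act (antipodeInv g) (b i)))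
      (by intro g₁ g₂ h; rw [← Matrix.mulVec_add]; congr 1; ext i; simp)
      (by intro c g h; rw [← Matrix.mulVec_smul]; congr 1; ext i; simp)
      (by intro g h₁ h₂; rw [map_add, Matrix.add_mulVec])
      (by intro c g h; rw [map_smul, Matrix.smul_mulVec]))
    (comul (R := ℂ) f)

/-- An invariant projection: a square matrix `P` over `B` with `P² = P = P†`, together with the
finite dimensional *-representation `ρ°` of the opposite algebra `U°` (unital, by matrices)
with respect to which `P` is `ad°_R`-invariant. -/
structure InvariantProjection (M : ModuleStarAlgebra U B) (σ : B ≃ₐ[ℂ] B) where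
  size : ℕ
  rep : Uᵐᵒᵖ →⋆ₐ[ℂ] Matrix (Fin size) (Fin size) ℂ
  mat : Matrix (Fin size) (Fin size) B
  idem : mat * mat = mat
  selfAdjoint : dagger σ mat = mat
  invariant : ∀ f : U, adR M rep f mat = counit (R := ℂ) f • mat

/-- Murray-von Neumann equivalence of invariant projections `P`, `Q`: there is
`V ∈ Hom_B(Bⁿ, Bᵐ) = M_{m×n}(B)` with `V†V = P`, `VV† = Q` and `π₂°(f) V = V π₁°(f)`. -/
def MvNEquiv {M : ModuleStarAlgebra U B} {σ : B ≃ₐ[ℂ] B} (P Q : InvariantProjection M σ) : Prop :=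
  ∃ V : Matrix (Fin Q.size) (Fin P.size) B,
    dagger σ V * V = P.mat ∧ V * dagger σ V = Q.mat ∧
      ∀ (f : U) (b : Fin P.size → B),
        piRep M Q.rep f (V.mulVec b) = V.mulVec (piRep M P.rep f b)

/-- The block diagonal matrix `diag(X, Y)`. -/
def diagSum {R : Type*} [Zero R] {m n : ℕ} (X : Matrix (Fin m) (Fin m) R)
    (Y : Matrix (Fin n) (Fin n) R) : Matrix (Fin (m + n)) (Fin (m + n)) R :=
  Matrix.reindex finSumFinEquiv finSumFinEquiv (Matrix.fromBlocks X 0 0 Y)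

theorem diagSum_mul {R : Type*} [Ring R] {m n : ℕ} (X X' : Matrix (Fin m) (Fin m) R)
    (Y Y' : Matrix (Fin n) (Fin n) R) :
    diagSum X Y * diagSum X' Y' = diagSum (X * X') (Y * Y') := by
  simp [diagSum, Matrix.fromBlocks_multiply, Matrix.submatrix_mul_equiv]

theorem diagSum_add {R : Type*} [Ring R] {m n : ℕ} (X X' : Matrix (Fin m) (Fin m) R)
    (Y Y' : Matrix (Fin n) (Fin n) R) :
    diagSum X Y + diagSum X' Y' = diagSum (X + X') (Y + Y') := by
  ext i j
  simp only [diagSum, Matrix.add_apply, Matrix.reindex_apply, Matrix.submatrix_apply]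
  rcases finSumFinEquiv.symm i with i | i <;> rcases finSumFinEquiv.symm j with j | j <;> simp

theorem diagSum_map {R R' : Type*} [Zero R] [Zero R'] {m n : ℕ} (g : R → R') (hg : g 0 = 0)
    (X : Matrix (Fin m) (Fin m) R) (Y : Matrix (Fin n) (Fin n) R) :
    (diagSum X Y).map g = diagSum (X.map g) (Y.map g) := by
  ext i j
  simp only [diagSum, Matrix.map_apply, Matrix.reindex_apply, Matrix.submatrix_apply]
  rcases finSumFinEquiv.symm i with i | i <;> rcases finSumFinEquiv.symm j with j | j <;> simp [hg]

theorem diagSum_smul {R : Type*} [Ring R] [Module ℂ R] {m n : ℕ} (c : ℂ)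
    (X : Matrix (Fin m) (Fin m) R) (Y : Matrix (Fin n) (Fin n) R) :
    diagSum (c • X) (c • Y) = c • diagSum X Y := by
  ext i j
  simp only [diagSum, Matrix.smul_apply, Matrix.reindex_apply, Matrix.submatrix_apply]
  rcases finSumFinEquiv.symm i with i | i <;> rcases finSumFinEquiv.symm j with j | j <;> simp

/-- The direct sum `ρ₁° ⊕ ρ₂°` of two *-representations. -/
def repSum {m n : ℕ} (ρ₁ : Uᵐᵒᵖ →⋆ₐ[ℂ] Matrix (Fin m) (Fin m) ℂ)
    (ρ₂ : Uᵐᵒᵖ →⋆ₐ[ℂ] Matrix (Fin n) (Fin n) ℂ) :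
    Uᵐᵒᵖ →⋆ₐ[ℂ] Matrix (Fin (m + n)) (Fin (m + n)) ℂ where
  toFun f := diagSum (ρ₁ f) (ρ₂ f)
  map_one' := by simp [diagSum]
  map_mul' f g := by rw [diagSum_mul, map_mul, map_mul]
  map_zero' := by simp [diagSum]
  map_add' f g := by rw [diagSum_add, map_add, map_add]
  commutes' c := by
    rw [AlgHomClass.commutes, AlgHomClass.commutes]
    simp only [Algebra.algebraMap_eq_smul_one, diagSum_smul]
    simp [diagSum]
  map_star' f := by
    rw [map_star, map_star]
    simp [diagSum, Matrix.star_eq_conjTranspose, Matrix.fromBlocks_conjTranspose]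

theorem repMatrix_repSum {m n : ℕ} (ρ₁ : Uᵐᵒᵖ →⋆ₐ[ℂ] Matrix (Fin m) (Fin m) ℂ)
    (ρ₂ : Uᵐᵒᵖ →⋆ₐ[ℂ] Matrix (Fin n) (Fin n) ℂ) (f : U) :
    repMatrix B (repSum ρ₁ ρ₂) f = diagSum (repMatrix B ρ₁ f) (repMatrix B ρ₂ f) :=
  diagSum_map _ (map_zero _) _ _

theorem adRTensor_diagSum (M : ModuleStarAlgebra U B) {m n : ℕ}
    (ρ₁ : Uᵐᵒᵖ →⋆ₐ[ℂ] Matrix (Fin m) (Fin m) ℂ) (ρ₂ : Uᵐᵒᵖ →⋆ₐ[ℂ] Matrix (Fin n) (Fin n) ℂ)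
    (X : Matrix (Fin m) (Fin m) B) (Y : Matrix (Fin n) (Fin n) B) (t : U ⊗[ℂ] (U ⊗[ℂ] U)) :
    adRTensor M (repSum ρ₁ ρ₂) (diagSum X Y) t =
      diagSum (adRTensor M ρ₁ X t) (adRTensor M ρ₂ Y t) := by
  induction t with
  | zero => simp [diagSum]
  | add x y hx hy => rw [map_add, map_add, map_add, hx, hy, diagSum_add]
  | tmul f s =>
    induction s with
    | zero => simp [diagSum]
    | add x y hx hy => rw [tmul_add, map_add, map_add, map_add, hx, hy, diagSum_add]
    | tmul g h =>
      have hX : actMatrix M (diagSum X Y) (antipodeInv (antipodeInv g)) =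
          diagSum (actMatrix M X (antipodeInv (antipodeInv g)))
            (actMatrix M Y (antipodeInv (antipodeInv g))) :=
        diagSum_map _ (map_zero _) _ _
      simp only [adRTensor, LinearMap.comp_apply, TensorProduct.map_tmul, LinearMap.mul'_apply,
        repMatrix_repSum, hX, diagSum_mul]

/-- `P ⊕ Q = diag(P, Q)`, invariant with respect to `ρ₁° ⊕ ρ₂°`. -/
def InvariantProjection.directSum {M : ModuleStarAlgebra U B} {σ : B ≃ₐ[ℂ] B}
    (P Q : InvariantProjection M σ) : InvariantProjection M σ where
  size := P.size + Q.size
  rep := repSum P.rep Q.rep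
  mat := diagSum P.mat Q.mat
  idem := by rw [diagSum_mul, P.idem, Q.idem]
  selfAdjoint := by
    have hP := P.selfAdjoint
    have hQ := Q.selfAdjoint
    unfold dagger at hP hQ ⊢
    rw [diagSum_map _ (map_zero _)]
    conv_rhs => rw [← hP, ← hQ]
    simp [diagSum, Matrix.fromBlocks_conjTranspose]
  invariant f := by
    have hP := P.invariant f
    have hQ := Q.invariant f
    unfold adR at hP hQ ⊢
    rw [adRTensor_diagSum, hP, hQ, diagSum_smul]

variable (M : ModuleStarAlgebra U B) (σ : B ≃ₐ[ℂ] B)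

/-- The relations `[P] = [Q]` for Murray-von Neumann equivalent invariant projections and
`[P ⊕ Q] = [P] + [Q]`. -/
def k0Relations : AddSubgroup (FreeAbelianGroup (InvariantProjection M σ)) :=
  AddSubgroup.closure
    ({x | ∃ P Q : InvariantProjection M σ, MvNEquiv P Q ∧
        x = FreeAbelianGroup.of P - FreeAbelianGroup.of Q} ∪
      {x | ∃ P Q : InvariantProjection M σ,
        x = FreeAbelianGroup.of (P.directSum Q) -
          (FreeAbelianGroup.of P + FreeAbelianGroup.of Q)})

/-- The equivariant K-group `K₀^U(B)`: the Grothendieck group of the additive semigroup of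
Murray-von Neumann classes of `ad°_R`-invariant projections of any size with
`[P] + [Q] = [P ⊕ Q]`, presented by generators and relations. -/
abbrev K0 : Type _ := FreeAbelianGroup (InvariantProjection M σ) ⧸ k0Relations M σ

variable {M σ}

/-- The class `[P]` in `K₀^U(B)`. -/
def K0.of (P : InvariantProjection M σ) : K0 M σ :=
  QuotientAddGroup.mk (FreeAbelianGroup.of P)

end KTheory

/-! ### Twisted cyclic cohomology -/

section Cyclic

/-- The face operator `d_{n+1,i}` (`i ≤ n`) on elementary tensors:
`(a₀, …, a_{n+1}) ↦ (a₀, …, aᵢ aᵢ₊₁, …, a_{n+1})`. -/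
def face {B : Type*} [Mul B] {n : ℕ} (i : Fin (n + 1)) (a : Fin (n + 2) → B) : Fin (n + 1) → B :=
  Fin.contractNth i.castSucc (· * ·) a

/-- The twisted last face operator on elementary tensors:
`(a₀, …, a_{n+1}) ↦ (λ(a_{n+1}) a₀, a₁, …, a_n)`. -/
def lastFace {B : Type*} [Mul B] (lam : B → B) {n : ℕ} (a : Fin (n + 2) → B) : Fin (n + 1) → B :=
  Fin.cons (lam (a (Fin.last (n + 1))) * a 0) (fun i : Fin n => a i.succ.castSucc)

/-- The twisted cyclic operator on elementary tensors:
`(a₀, …, a_n) ↦ (λ(a_n), a₀, …, a_{n-1})`. -/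
def cyc {B : Type*} (lam : B → B) {n : ℕ} (a : Fin (n + 1) → B) : Fin (n + 1) → B :=
  Fin.cons (lam (a (Fin.last n))) (fun i : Fin n => a i.castSucc)

variable {B : Type*} [Ring B] [Algebra ℂ B]

/-- The space of `(n+1)`-linear forms on `B`, i.e. the dual of `B^{⊗(n+1)}`. -/
abbrev Cochain (B : Type*) [Ring B] [Algebra ℂ B] (n : ℕ) : Type _ :=
  MultilinearMap ℂ (fun _ : Fin (n + 1) => B) ℂ

variable (lam : B ≃ₐ[ℂ] B)

/-- The linear map `φ ↦ φ ∘ g` on multilinear forms, for a map `g` between tuples such that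
varying one entry of `a` varies exactly one entry of `g a`, linearly. -/
def pullback {p q : ℕ} (g : (Fin (p + 1) → B) → (Fin (q + 1) → B))
    (hg : ∀ a j, ∃ (j' : Fin (q + 1)) (L : B →ₗ[ℂ] B),
      ∀ x, g (Function.update a j x) = Function.update (g a) j' (L x)) :
    Cochain B q →ₗ[ℂ] Cochain B p where
  toFun φ := MultilinearMap.mk' (fun a => φ (g a))
    (fun a j x y => by obtain ⟨j', L, h⟩ := hg a j; simp [h])
    (fun a j c x => by obtain ⟨j', L, h⟩ := hg a j; simp [h])
  map_add' φ ψ := by ext; simp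
  map_smul' c φ := by ext; simp

theorem face_update {n : ℕ} (i : Fin (n + 1)) (a : Fin (n + 2) → B) (j : Fin (n + 2)) :
    ∃ (j' : Fin (n + 1)) (L : B →ₗ[ℂ] B),
      ∀ x, face i (Function.update a j x) = Function.update (face i a) j' (L x) := by
  rcases lt_trichotomy j i.castSucc with h | h | h
  · refine ⟨⟨j, by grind⟩, LinearMap.id, fun x => ?_⟩
    funext l
    simp only [face, Fin.contractNth, Function.update_apply, Fin.ext_iff, LinearMap.id_apply]
    grind
  · refine ⟨i, LinearMap.mulRight ℂ (a i.succ), fun x => ?_⟩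
    funext l
    simp only [face, Fin.contractNth, Function.update_apply, Fin.ext_iff,
      LinearMap.mulRight_apply]
    grind
  · by_cases h' : j = i.succ
    · refine ⟨i, LinearMap.mulLeft ℂ (a i.castSucc), fun x => ?_⟩
      funext l
      simp only [face, Fin.contractNth, Function.update_apply, Fin.ext_iff,
        LinearMap.mulLeft_apply]
      grind
    · refine ⟨⟨j - 1, by grind⟩, LinearMap.id, fun x => ?_⟩
      funext l
      simp only [face, Fin.contractNth, Function.update_apply, Fin.ext_iff, LinearMap.id_apply]
      grind

theorem lastFace_update {n : ℕ} (a : Fin (n + 2) → B) (j : Fin (n + 2)) :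
    ∃ (j' : Fin (n + 1)) (L : B →ₗ[ℂ] B),
      ∀ x, lastFace lam (Function.update a j x) = Function.update (lastFace lam a) j' (L x) := by
  by_cases h0 : j = 0
  · subst h0
    refine ⟨0, LinearMap.mulLeft ℂ (lam (a (Fin.last (n + 1)))), fun x => ?_⟩
    funext l
    refine Fin.cases ?_ (fun l => ?_) l
    · simp [lastFace, Fin.ext_iff]
    · simp [lastFace, Fin.ext_iff]
  · by_cases h1 : j = Fin.last (n + 1)
    · subst h1
      refine ⟨0, LinearMap.mulRight ℂ (a 0) ∘ₗ lam.toLinearMap, fun x => ?_⟩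
      funext l
      refine Fin.cases ?_ (fun l => ?_) l
      · simp [lastFace, Function.update_apply, Fin.ext_iff]
      · have := l.isLt
        simp [lastFace, Function.update_apply, Fin.ext_iff]
        intro h; omega
    · refine ⟨⟨j, by grind⟩, LinearMap.id, fun x => ?_⟩
      funext l
      refine Fin.cases ?_ (fun l => ?_) l
      · simp [lastFace, Function.update_apply, Fin.ext_iff]
        grind
      · simp [lastFace, Function.update_apply, Fin.ext_iff]

theorem cyc_update {n : ℕ} (a : Fin (n + 1) → B) (j : Fin (n + 1)) :
    ∃ (j' : Fin (n + 1)) (L : B →ₗ[ℂ] B),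
      ∀ x, cyc lam (Function.update a j x) = Function.update (cyc lam a) j' (L x) := by
  by_cases h1 : j = Fin.last n
  · subst h1
    refine ⟨0, lam.toLinearMap, fun x => ?_⟩
    funext l
    refine Fin.cases ?_ (fun l => ?_) l
    · simp [cyc]
    · have := l.isLt
      simp [cyc, Function.update_apply, Fin.ext_iff]
      intro h; omega
  · refine ⟨⟨j + 1, by grind⟩, LinearMap.id, fun x => ?_⟩
    funext l
    refine Fin.cases ?_ (fun l => ?_) l
    · have h2 : Fin.last n ≠ j := fun h => h1 h.symm
      have h3 : (0 : Fin (n + 1)) ≠ ⟨j + 1, by grind⟩ :=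
        fun h => Nat.succ_ne_zero j (congrArg Fin.val h).symm
      rw [Function.update_of_ne h3]
      simp only [cyc, Fin.cons_zero, Function.update_of_ne h2]
    · simp only [cyc, Fin.cons_succ, Function.update_apply, Fin.ext_iff, Fin.val_succ,
        Fin.val_castSucc, add_left_inj, LinearMap.id_apply]

/-- The dual of `d_{n+1,i}`. -/
def faceDual {n : ℕ} (i : Fin (n + 1)) : Cochain B n →ₗ[ℂ] Cochain B (n + 1) :=
  pullback (face i) (face_update i)

/-- The dual of the twisted last face operator. -/
def lastFaceDual {n : ℕ} : Cochain B n →ₗ[ℂ] Cochain B (n + 1) :=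
  pullback (lastFace lam) (lastFace_update lam)

/-- The dual `φ ↦ ((a₀, …, a_n) ↦ φ(λ(a_n), a₀, …, a_{n-1}))` of the twisted cyclic operator. -/
def cycDual {n : ℕ} : Cochain B n →ₗ[ℂ] Cochain B n :=
  pullback (cyc lam) (cyc_update lam)

/-- The dual `φ ↦ φ(1, ·, …, ·)` of the extra degeneracy. -/
def extraDual {n : ℕ} : Cochain B (n + 1) →ₗ[ℂ] Cochain B n where
  toFun φ := φ.curryLeft 1
  map_add' φ ψ := by ext; simp
  map_smul' c φ := by ext; simp

/-- The coboundary `b*`, dual to `b = ∑_{i ≤ n} (-1)ⁱ d_{n+1,i} + (-1)^{n+1} d^λ_{n+1,n+1}`. -/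
def bDual {n : ℕ} : Cochain B n →ₗ[ℂ] Cochain B (n + 1) :=
  (∑ i : Fin (n + 1), (-1 : ℂ) ^ (i : ℕ) • faceDual i) + (-1 : ℂ) ^ (n + 1) • lastFaceDual lam

/-- The operator dual to `N_n = ∑_{j ≤ n} (-1)^{n j} τ_n^j`. -/
def normDual {n : ℕ} : Cochain B n →ₗ[ℂ] Cochain B n :=
  ∑ j ∈ Finset.range (n + 1), (-1 : ℂ) ^ (n * j) • (cycDual lam) ^ j

/-- The operator dual to Connes' `B_n = (1 - (-1)^{n+1} τ_{n+1}) s_n N_n`. -/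
def BDual {n : ℕ} : Cochain B (n + 1) →ₗ[ℂ] Cochain B n :=
  normDual lam ∘ₗ extraDual ∘ₗ (LinearMap.id - (-1 : ℂ) ^ (n + 1) • cycDual lam)

/-- The differential of the dual `(b, B)`-bicomplex on families of cochains of all degrees. -/
def totalDiff : (∀ m, Cochain B m) →ₗ[ℂ] (∀ m, Cochain B m) :=
  LinearMap.pi fun m => match m with
    | 0 => BDual lam ∘ₗ LinearMap.proj 1
    | m + 1 => bDual lam ∘ₗ LinearMap.proj m + BDual lam ∘ₗ LinearMap.proj (m + 2)

/-- The cochains of total degree `N` of the dual `(b, B)`-bicomplex: families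
`(ψ_N, ψ_{N-2}, ψ_{N-4}, …)`, where each `ψ_m` is a linear form on the cokernel
`B^{⊗(m+1)} / im(id - (τ_m^λ)^{m+1})`, that is, an `(m+1)`-linear form with
`ψ_m(λ(a₀), …, λ(a_m)) = ψ_m(a₀, …, a_m)`. -/
def totalCochains (N : ℕ) : Submodule ℂ (∀ m, Cochain B m) where
  carrier := {ψ | (∀ m, ¬ (m ≤ N ∧ m % 2 = N % 2) → ψ m = 0) ∧
    ∀ m a, ψ m (fun i => lam (a i)) = ψ m a}
  add_mem' := by
    rintro ψ φ ⟨h1, h2⟩ ⟨h3, h4⟩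
    refine ⟨fun m hm => ?_, fun m a => ?_⟩
    · simp [h1 m hm, h3 m hm]
    · simp [h2 m a, h4 m a]
  zero_mem' := by simp
  smul_mem' := by
    rintro c ψ ⟨h1, h2⟩
    refine ⟨fun m hm => ?_, fun m a => ?_⟩
    · simp [h1 m hm]
    · simp [h2 m a]

/-- The cocycles of total degree `N`. -/
def totalCocycles (N : ℕ) : Submodule ℂ (∀ m, Cochain B m) :=
  totalCochains lam N ⊓ LinearMap.ker (totalDiff lam)

/-- The coboundaries of total degree `N`. -/
def totalCoboundaries (N : ℕ) : Submodule ℂ (∀ m, Cochain B m) :=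
  match N with
  | 0 => ⊥
  | N + 1 => (totalCochains lam N).map (totalDiff lam)

/-- The twisted cyclic cohomology `HC_λ^N(B)`, computed by the dual `(b, B)`-bicomplex. -/
abbrev HC (N : ℕ) : Type _ :=
  totalCocycles lam N ⧸ (totalCoboundaries lam N).submoduleOf (totalCocycles lam N)

variable {lam} in
/-- The class of a cocycle of the dual `(b, B)`-bicomplex. -/
def HC.of {N : ℕ} (ψ : totalCocycles lam N) : HC lam N :=
  Submodule.Quotient.mk ψ

/-- The twisted cyclic `n`-cocycles: `(n+1)`-linear forms `φ` with `φ = (-1)ⁿ τ* φ` and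
`b* φ = 0`. -/
def cyclicCocycles (n : ℕ) : Submodule ℂ (Cochain B n) :=
  LinearMap.ker (LinearMap.id - (-1 : ℂ) ^ n • cycDual lam) ⊓ LinearMap.ker (bDual lam)

theorem cyc_iterate {n : ℕ} (a : Fin (n + 1) → B) (j : ℕ) (hj : j ≤ n + 1) (l : Fin (n + 1)) :
    (cyc lam)^[j] a l =
      if h : (l : ℕ) < j then lam (a ⟨l + (n + 1) - j, by omega⟩) else a ⟨l - j, by omega⟩ := by
  induction j generalizing l with
  | zero => simp
  | succ j ih =>
    rw [Function.iterate_succ_apply']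
    have ih' := fun l => ih (by omega) l
    refine Fin.cases ?_ (fun l => ?_) l
    · simp only [cyc, Fin.cons_zero]
      rw [ih', dif_neg (by simp; omega), dif_pos (by simp)]
      congr 2
      ext
      simp only [Fin.val_last, Fin.val_zero]
      omega
    · simp only [cyc, Fin.cons_succ]
      rw [ih']
      by_cases h : (l : ℕ) < j
      · rw [dif_pos (by simpa using h), dif_pos (by simpa using h)]
        congr 2
        ext; simp; omega
      · rw [dif_neg (by simpa using h), dif_neg (by simpa using h)]
        congr 1
        ext
        simp

/-- A form with `φ = (-1)ⁿ τ* φ` is `λ`-invariant. -/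
theorem cyclic_apply_lam {n : ℕ} (φ : Cochain B n)
    (hφ : φ - (-1 : ℂ) ^ n • cycDual lam φ = 0) (a : Fin (n + 1) → B) :
    φ (fun i => lam (a i)) = φ a := by
  have h : ∀ a, φ (cyc lam a) = (-1 : ℂ) ^ n * φ a := by
    intro a
    have := congrArg (fun ψ : Cochain B n => ψ a) hφ
    have e : φ a - (-1 : ℂ) ^ n * φ (cyc lam a) = 0 := this
    rw [sub_eq_zero.mp e, ← mul_assoc, ← mul_pow]
    simp
  have h' : ∀ j, φ ((cyc lam)^[j] a) = ((-1 : ℂ) ^ n) ^ j * φ a := by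
    intro j
    induction j with
    | zero => simp
    | succ j ih => rw [Function.iterate_succ_apply', h, ih, pow_succ]; ring
  have e : (cyc lam)^[n + 1] a = fun i => lam (a i) := by
    funext l
    rw [cyc_iterate lam a (n + 1) le_rfl l, dif_pos l.isLt]
    congr 2
    ext; simp
  have := h' (n + 1)
  rw [e, ← pow_mul, Even.neg_one_pow (Nat.even_mul_succ_self n), one_mul] at this
  exact this

theorem single_mem_totalCocycles {n : ℕ} (φ : cyclicCocycles lam n) :
    (Pi.single n (φ : Cochain B n) : ∀ m, Cochain B m) ∈ totalCocycles lam n := by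
  obtain ⟨φ, hφ⟩ := φ
  have h1 : φ - (-1 : ℂ) ^ n • cycDual lam φ = 0 := hφ.1
  have h2 : bDual lam φ = 0 := hφ.2
  have hinv := cyclic_apply_lam lam φ h1
  refine ⟨⟨fun m hm => ?_, fun m a => ?_⟩, ?_⟩
  · have : m ≠ n := by rintro rfl; simp at hm
    simp [this]
  · by_cases h : m = n
    · subst h; simpa using hinv a
    · simp [h]
  · change _ = _
    have hB : ∀ m, n = m + 1 →
        BDual lam ((Pi.single n φ : ∀ m, Cochain B m) (m + 1)) = 0 := by
      rintro m rfl
      simp [BDual, h1]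
    funext m
    match m with
    | 0 =>
      change BDual lam ((Pi.single n φ : ∀ m, Cochain B m) 1) = 0
      by_cases h : n = 1
      · exact hB 0 h
      · rw [Pi.single_eq_of_ne (Ne.symm h), map_zero]
    | m + 1 =>
      change bDual lam ((Pi.single n φ : ∀ m, Cochain B m) m) +
        BDual lam ((Pi.single n φ : ∀ m, Cochain B m) (m + 2)) = 0
      have e1 : bDual lam ((Pi.single n φ : ∀ m, Cochain B m) m) = 0 := by
        by_cases h : m = n
        · subst h; simpa using h2
        · rw [Pi.single_eq_of_ne h, map_zero]
      have e2 : BDual lam ((Pi.single n φ : ∀ m, Cochain B m) (m + 2)) = 0 := by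
        by_cases h : n = m + 2
        · exact hB (m + 1) h
        · rw [Pi.single_eq_of_ne (Ne.symm h), map_zero]
      rw [e1, e2, add_zero]

variable {lam} in
/-- The class `[Φ] ∈ HC_λⁿ(B)` of a twisted cyclic `n`-cocycle `Φ`, represented by `Φ` in
degree `n` and zeros elsewhere. -/
def cyclicClass {n : ℕ} (φ : cyclicCocycles lam n) : HC lam n :=
  HC.of ⟨_, single_mem_totalCocycles lam φ⟩

/-- The evaluation of an `(n+1)`-linear form on an element of `B^{⊗(n+1)}`. -/
def evalCochain {n : ℕ} (φ : Cochain B n) : (⨂[ℂ] _i : Fin (n + 1), B) →ₗ[ℂ] ℂ :=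
  PiTensorProduct.lift φ

end Cyclic

/-! ### The twisted Chern character -/

section Chern

variable {U B : Type*} [Ring U] [HopfAlgebra ℂ U] [StarRing U] [StarModule ℂ U]
  [Ring B] [Algebra ℂ B] [StarRing B] [StarModule ℂ B]

/-- The quantum trace
`Tr_λ(A₀ ⊗ ⋯ ⊗ A_n) = ∑ ρ°(k)_{j_{n+1} j₀} a⁰_{j₀ j₁} ⊗ ⋯ ⊗ aⁿ_{j_n j_{n+1}}`. -/
def quantumTrace {m : ℕ} (ρ : Uᵐᵒᵖ →⋆ₐ[ℂ] Matrix (Fin m) (Fin m) ℂ) (k : U) {n : ℕ}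
    (A : Fin (n + 1) → Matrix (Fin m) (Fin m) B) : ⨂[ℂ] _i : Fin (n + 1), B :=
  ∑ j : Fin (n + 2) → Fin m, ρ (MulOpposite.op k) (j (Fin.last (n + 1))) (j 0) •
    PiTensorProduct.tprod ℂ (fun i : Fin (n + 1) => A i (j i.castSucc) (j i.succ))

/-- `Tr_λ(P ⊗ ⋯ ⊗ P)` with `n + 1` factors `P`. -/
def traceOf {M : ModuleStarAlgebra U B} {σ : B ≃ₐ[ℂ] B} (k : U) (P : InvariantProjection M σ)
    (n : ℕ) : ⨂[ℂ] _i : Fin (n + 1), B :=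
  quantumTrace P.rep k (fun _ => P.mat)

/-- The component in `B^{⊗(2i+1)}` of the `(b, B)`-cycle representing the twisted Chern character:
`(-1)ⁱ (2i)!/i! Tr_λ(P^{⊗(2i+1)} - ½ (1 ⊗ P^{⊗2i} - P ⊗ 1 ⊗ P^{⊗(2i-1)}))`.
The correction term (zero for `i = 0`) lies in `im(1 - τ)`; without it the leading terms do not
form a cycle of the unnormalised bicomplex. -/
def chernComponent {M : ModuleStarAlgebra U B} {σ : B ≃ₐ[ℂ] B} (k : U)
    (P : InvariantProjection M σ) (i : ℕ) : ⨂[ℂ] _j : Fin (2 * i + 1), B :=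
  let onePP : Fin (2 * i + 1) → Matrix (Fin P.size) (Fin P.size) B := Fin.cons 1 (fun _ => P.mat)
  ((-1 : ℂ) ^ i * ((Nat.factorial (2 * i) : ℂ) / (Nat.factorial i : ℂ))) •
    (traceOf k P (2 * i) -
      (1 / 2 : ℂ) • (quantumTrace P.rep k onePP - quantumTrace P.rep k (cyc id onePP)))

end Chern

end TwistedChern

end

/-! Two things need proof: evaluation on the Chern character kills coboundaries, and for a fixed
cocycle it depends only on the class of P in K-theory. Both are reduced to statements about plain
idempotents in an untwisted algebra.

Removing the twist. Put K = ρ°(k). Invariance of P at the group-like element k says λ(P)K = KP, so P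
lies in the algebra `covariantMatrices`. On that algebra the trace weighted by K turns the λ-twisted
cyclic operator into the ordinary one, and it respects faces and the extra degeneracy. It therefore
carries the twisted (b, B)-bicomplex of B to the untwisted one (`covariantForm_totalDiff`).

Coboundaries. On the constant tuple (e, …, e) every face and every rotation acts trivially, so b, b'
and the norm become scalars. With the factor -½ in the correction term and the recursion for
(-1)ⁱ(2i)!/i!, the b-part in degree 2i+2 cancels the B-part in degree 2i (`chernTerm_bDual`). The
sum telescopes to its top term.

Murray–von Neumann equivalence. If e + tf is idempotent for all t, then f = [fe - ef, e], so the
motion is infinitesimally inner. A Cartan homotopy adapted to the unnormalised complex writes the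
t-derivative of the Chern pairing as a transgression of (b* + B*)ψ
(`transgression_bDual_add_BDual`). It vanishes for a cocycle, so the pairing is constant along the
line (`sum_chernTerm_line`). Orthogonal equivalent idempotents are joined by three such segments
(`sum_chernTerm_eq_of_equiv`), and orthogonality is arranged by using complementary diagonal blocks.
V and V† are covariant because V intertwines the actions of group-like elements.

Additivity holds because the trace of block diagonal matrices splits. For a cyclic cocycle the
correction term drops out by cyclicity. -/

set_option linter.unusedSectionVars false

noncomputable section

namespace TwistedChern

/-! ### Operator identities in the cyclic bicomplex, mainly untwisted. -/

section Untwisted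

variable {A : Type*} [Ring A] [Algebra ℂ A]

theorem bDual_apply (lam : A ≃ₐ[ℂ] A) {n : ℕ} (φ : Cochain A n) (a : Fin (n + 2) → A) :
    bDual lam φ a = ∑ i : Fin (n + 1), (-1 : ℂ) ^ (i : ℕ) * φ (face i a) +
      (-1 : ℂ) ^ (n + 1) * φ (lastFace lam a) := by
  simp [bDual, faceDual, lastFaceDual, pullback]

theorem cycDual_apply (lam : A ≃ₐ[ℂ] A) {n : ℕ} (φ : Cochain A n) (a : Fin (n + 1) → A) :
    cycDual lam φ a = φ (cyc lam a) := rfl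

theorem extraDual_apply {n : ℕ} (φ : Cochain A (n + 1)) (a : Fin (n + 1) → A) :
    extraDual φ a = φ (Fin.cons 1 a) := rfl

/-- The alternating sum of the duals of all faces but the last. -/
def bPrimeDual {n : ℕ} : Cochain A n →ₗ[ℂ] Cochain A (n + 1) :=
  ∑ i : Fin (n + 1), (-1 : ℂ) ^ (i : ℕ) • faceDual i

theorem bPrimeDual_apply {n : ℕ} (φ : Cochain A n) (a : Fin (n + 2) → A) :
    bPrimeDual φ a = ∑ i : Fin (n + 1), (-1 : ℂ) ^ (i : ℕ) * φ (face i a) := by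
  simp [bPrimeDual, faceDual, pullback]

/-- The dual of `1 - (-1)ⁿ τ`. -/
def oneSubCyc (lam : A ≃ₐ[ℂ] A) {n : ℕ} : Cochain A n →ₗ[ℂ] Cochain A n :=
  LinearMap.id - (-1 : ℂ) ^ n • cycDual lam

theorem oneSubCyc_apply (lam : A ≃ₐ[ℂ] A) {n : ℕ} (φ : Cochain A n) (a : Fin (n + 1) → A) :
    oneSubCyc lam φ a = φ a - (-1 : ℂ) ^ n * φ (cyc lam a) := rfl

theorem BDual_apply (lam : A ≃ₐ[ℂ] A) {n : ℕ} (φ : Cochain A (n + 1)) :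
    BDual lam φ = normDual lam (extraDual (oneSubCyc lam φ)) := rfl

theorem face_zero_cons {n : ℕ} (x : A) (a : Fin (n + 1) → A) :
    face 0 (Fin.cons x a : Fin (n + 2) → A) = Fin.cons (x * a 0) (Fin.tail a) := by
  funext l
  refine Fin.cases ?_ (fun l => ?_) l
  · simp [face, Fin.contractNth]
  · simp [face, Fin.contractNth, Fin.tail]

theorem face_succ_cons {n : ℕ} (j : Fin (n + 1)) (x : A) (a : Fin (n + 2) → A) :
    face j.succ (Fin.cons x a : Fin (n + 3) → A) = Fin.cons x (face j a) := by
  funext l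
  refine Fin.cases ?_ (fun l => ?_) l
  · simp [face, Fin.contractNth]
  · simp [face, Fin.contractNth]

theorem lastFace_eq_face_cyc (lam : A → A) {n : ℕ} (a : Fin (n + 2) → A) :
    lastFace lam a = face 0 (cyc lam a) := by
  rw [cyc, face_zero_cons]
  funext l
  refine Fin.cases ?_ (fun l => ?_) l
  · simp [lastFace]
  · simp [lastFace, Fin.tail]

theorem lastFace_cons_one (lam : A ≃ₐ[ℂ] A) {n : ℕ} (a : Fin (n + 1) → A) :
    lastFace lam (Fin.cons 1 a : Fin (n + 2) → A) = cyc lam a := by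
  funext l
  refine Fin.cases ?_ (fun l => ?_) l
  · simp [lastFace, cyc, ← Fin.succ_last]
  · simp [lastFace, cyc]

theorem cyc_cons (lam : A → A) {n : ℕ} (x : A) (a : Fin (n + 1) → A) :
    cyc lam (Fin.cons x a : Fin (n + 2) → A) =
      Fin.cons (lam (a (Fin.last n))) (Fin.cons x (Fin.init a)) := by
  funext l
  refine Fin.cases ?_ (fun l => ?_) l
  · simp [cyc, ← Fin.succ_last]
  · refine Fin.cases ?_ (fun l => ?_) l
    · simp [cyc]
    · simp [cyc, Fin.init]

theorem init_face_castSucc {n : ℕ} (j : Fin (n + 1)) (a : Fin (n + 3) → A) :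
    Fin.init (face j.castSucc a) = face j (Fin.init a) := by
  funext l
  simp [Fin.init, face, Fin.contractNth]

theorem face_castSucc_last {n : ℕ} (j : Fin (n + 1)) (a : Fin (n + 3) → A) :
    face j.castSucc a (Fin.last (n + 1)) = a (Fin.last (n + 2)) := by
  have := j.isLt
  have h1 : ¬ (n + 1 < (j : ℕ)) := by omega
  have h2 : ¬ (n + 1 = (j : ℕ)) := by omega
  simp [face, Fin.contractNth, h1, h2]

theorem init_face_last {n : ℕ} (a : Fin (n + 2) → A) :
    Fin.init (face (Fin.last n) a) = Fin.init (Fin.init a) := by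
  funext l
  simp [Fin.init, face, Fin.contractNth]

theorem face_last_last {n : ℕ} (a : Fin (n + 2) → A) :
    face (Fin.last n) a (Fin.last n) = a (Fin.last n).castSucc * a (Fin.last (n + 1)) := by
  simp [face, Fin.contractNth]

/-- The extra degeneracy contracts the b'-complex: the zeroth face deletes the inserted 1, and every
other face is shifted by one place and changes sign. -/
theorem extraDual_bPrimeDual {n : ℕ} (φ : Cochain A (n + 1)) :
    extraDual (bPrimeDual φ) = φ - bPrimeDual (extraDual φ) := by
  ext a
  rw [extraDual_apply, bPrimeDual_apply, Fin.sum_univ_succ, sub_apply,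
    bPrimeDual_apply]
  simp [face_zero_cons, face_succ_cons, extraDual_apply, pow_succ]
  ring

theorem init_cons {n : ℕ} (x : A) (a : Fin (n + 1) → A) :
    Fin.init (Fin.cons x a : Fin (n + 2) → A) = Fin.cons x (Fin.init a) := by
  funext l
  refine Fin.cases ?_ (fun l => ?_) l
  · simp [Fin.init]
  · simp [Fin.init]

theorem lastFace_cons (lam : A → A) {n : ℕ} (x : A) (a : Fin (n + 1) → A) :
    lastFace lam (Fin.cons x a : Fin (n + 2) → A) =
      Fin.cons (lam (a (Fin.last n)) * x) (Fin.init a) := by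
  funext l
  refine Fin.cases ?_ (fun l => ?_) l
  · simp [lastFace, ← Fin.succ_last]
  · simp [lastFace, Fin.init]

theorem cons_last_cons (x : A) {n : ℕ} (a : Fin (n + 1) → A) :
    (Fin.cons x a : Fin (n + 2) → A) (Fin.last (n + 1)) = a (Fin.last n) := by
  rw [← Fin.succ_last, Fin.cons_succ]

/-- In (a_{n+1}, 1, a₀, …, a_n) the two faces that absorb the 1 give the same tuple with opposite
signs. The wrap-around face produces a_n a_{n+1}, which is the last ordinary face of a. -/
theorem bDual_cyc_cons_one {n : ℕ} (φ : Cochain A (n + 1)) (a : Fin (n + 2) → A) :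
    bDual .refl φ (cyc (AlgEquiv.refl : A ≃ₐ[ℂ] A) (Fin.cons 1 a)) =
      ∑ j : Fin (n + 1), (-1 : ℂ) ^ (j : ℕ) *
        φ (cyc (AlgEquiv.refl : A ≃ₐ[ℂ] A) (Fin.cons 1 (face j a))) := by
  conv_rhs => rw [Fin.sum_univ_castSucc]
  rw [bDual_apply, Fin.sum_univ_succ, Fin.sum_univ_succ]
  have e : (Fin.cons (a 0) (Fin.tail (Fin.init a)) : Fin (n + 1) → A) = Fin.init a :=
    Fin.cons_self_tail (Fin.init a)
  have e0 : Fin.init a 0 = a 0 := rfl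
  have e1 : Fin.init a (Fin.last n) = a (Fin.last n).castSucc := rfl
  cases n with
  | zero =>
    simp only [cyc_cons, lastFace_cons, face_zero_cons, face_succ_cons, init_cons, cons_last_cons,
      init_face_last, face_last_last]
    simp [e0, e]
  | succ n =>
    simp only [cyc_cons, lastFace_cons, face_zero_cons, face_succ_cons, init_cons, cons_last_cons,
      init_face_last, face_last_last, init_face_castSucc, face_castSucc_last]
    simp [e0, e1, pow_succ, e]

/-- Dual to b(1-τ)s = (1-τ)b's = (1-τ)(1-sb'), with signs absorbed in τ. This is the one relation
between b and B that both the coboundary and the homotopy arguments use. -/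
theorem extraDual_oneSubCyc_bDual {n : ℕ} (φ : Cochain A (n + 1)) :
    extraDual (oneSubCyc .refl (bDual .refl φ)) =
      oneSubCyc .refl φ - bPrimeDual (extraDual (oneSubCyc .refl φ)) := by
  ext a
  have h1 : bDual .refl φ (Fin.cons 1 a) = φ a +
      ∑ j : Fin (n + 1), (-1 : ℂ) ^ (j + 1 : ℕ) * φ (Fin.cons 1 (face j a)) +
        (-1 : ℂ) ^ (n + 2) * φ (cyc (AlgEquiv.refl : A ≃ₐ[ℂ] A) a) := by
    rw [bDual_apply, Fin.sum_univ_succ, lastFace_cons_one]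
    simp [face_zero_cons, face_succ_cons]
  have h2 : bDual .refl φ (cyc (AlgEquiv.refl : A ≃ₐ[ℂ] A) (Fin.cons 1 a)) =
      ∑ j : Fin (n + 1), (-1 : ℂ) ^ (j : ℕ) *
        φ (cyc (AlgEquiv.refl : A ≃ₐ[ℂ] A) (Fin.cons 1 (face j a))) :=
    bDual_cyc_cons_one φ a
  rw [extraDual_apply, oneSubCyc_apply, h1, h2]
  simp only [sub_apply, bPrimeDual_apply, extraDual_apply, oneSubCyc_apply]
  simp only [mul_sub, Finset.sum_sub_distrib, pow_succ, Finset.mul_sum]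
  simp
  ring_nf

theorem cycDual_pow_apply (lam : A ≃ₐ[ℂ] A) {n : ℕ} (j : ℕ) (φ : Cochain A n)
    (a : Fin (n + 1) → A) : (cycDual lam ^ j) φ a = φ ((cyc lam)^[j] a) := by
  induction j generalizing a with
  | zero => rfl
  | succ j ih => rw [pow_succ', Module.End.mul_apply, cycDual_apply, ih, Function.iterate_succ_apply]

theorem normDual_apply (lam : A ≃ₐ[ℂ] A) {n : ℕ} (φ : Cochain A n) (a : Fin (n + 1) → A) :
    normDual lam φ a = ∑ j ∈ Finset.range (n + 1), (-1 : ℂ) ^ (n * j) * φ ((cyc lam)^[j] a) := by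
  simp [normDual, cycDual_pow_apply]

/-- Without a twist the signed rotation t satisfies t^(n+1) = 1, so 1 - t kills the geometric sum.
-/
theorem oneSubCyc_normDual {n : ℕ} (φ : Cochain A n) :
    oneSubCyc .refl (normDual .refl φ) = 0 := by
  let t : Module.End ℂ (Cochain A n) := (-1 : ℂ) ^ n • cycDual .refl
  have h1 : (normDual .refl : Module.End ℂ (Cochain A n)) = ∑ j ∈ Finset.range (n + 1), t ^ j := by
    simp only [normDual, t, smul_pow, pow_mul]
  have h2 : t ^ (n + 1) = 1 := by
    simp only [t, smul_pow, ← pow_mul, (Nat.even_mul_succ_self n).neg_one_pow, one_smul]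
    ext φ a
    rw [cycDual_pow_apply]
    change φ _ = φ a
    congr 1
    funext l
    rw [cyc_iterate _ a (n + 1) le_rfl l, dif_pos l.isLt]
    change a _ = a l
    congr 1
    ext
    simp
  have h3 := mul_neg_geom_sum t (n + 1)
  rw [h2, sub_self, ← h1] at h3
  exact LinearMap.congr_fun h3 φ

/-! ### The Chern character of an idempotent and its cycle property. -/

section Idempotent

theorem face_const {e : A} (he : e * e = e) {n : ℕ} (j : Fin (n + 1)) :
    face j (fun _ : Fin (n + 2) => e) = fun _ => e := by
  funext l
  simp [face, Fin.contractNth, he]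

theorem cyc_refl_const (e : A) {n : ℕ} :
    cyc (AlgEquiv.refl : A ≃ₐ[ℂ] A) (fun _ : Fin (n + 1) => e) = fun _ => e := by
  funext l
  refine Fin.cases ?_ (fun l => ?_) l <;> simp [cyc]

/-- An alternating sum of an odd number of equal terms; the same parity count gives `bDual_const` in
odd degree. -/
theorem bPrimeDual_const {e : A} (he : e * e = e) {n : ℕ} (hn : Even n) (φ : Cochain A n) :
    bPrimeDual φ (fun _ => e) = φ (fun _ => e) := by
  simp only [bPrimeDual_apply, face_const he]
  rw [← Finset.sum_mul, Fin.sum_univ_eq_sum_range (fun i => (-1 : ℂ) ^ i), neg_one_geom_sum,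
    if_neg (by grind), one_mul]

theorem normDual_const (e : A) {n : ℕ} (hn : Even n) (φ : Cochain A n) :
    normDual .refl φ (fun _ => e) = (n + 1) * φ (fun _ => e) := by
  have h : ∀ j, (cyc (AlgEquiv.refl : A ≃ₐ[ℂ] A))^[j] (fun _ : Fin (n + 1) => e) = fun _ => e :=
    fun j => Function.iterate_fixed (cyc_refl_const e) j
  simp only [normDual_apply, h, pow_mul, hn.neg_one_pow]
  simp

theorem bDual_const {e : A} (he : e * e = e) {n : ℕ} (hn : Odd n) (φ : Cochain A n) :
    bDual .refl φ (fun _ => e) = φ (fun _ => e) := by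
  simp only [bDual_apply, face_const he, lastFace_eq_face_cyc, cyc_refl_const]
  rw [← Finset.sum_mul, Fin.sum_univ_eq_sum_range (fun i => (-1 : ℂ) ^ i), neg_one_geom_sum,
    if_pos (by grind), Even.neg_one_pow (by grind)]
  ring

/-- The coefficient `(-1)ⁱ (2i)! / i!`. -/
def chernCoeff (i : ℕ) : ℂ := (-1 : ℂ) ^ i * ((Nat.factorial (2 * i) : ℂ) / (Nat.factorial i : ℂ))

/-- The factor 2i+1 comes from the norm on a constant tuple and -2 offsets the ½ of the correction
term. This recursion dictates the normalisation of the Chern character. -/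
theorem chernCoeff_succ (i : ℕ) : chernCoeff (i + 1) = -2 * (2 * i + 1) * chernCoeff i := by
  have h := Nat.factorial_ne_zero i
  have h1 : ((i : ℂ) + 1) ≠ 0 := by exact_mod_cast Nat.succ_ne_zero i
  simp only [chernCoeff, Nat.mul_succ, Nat.factorial_succ]
  push_cast
  field_simp
  ring

/-- The pairing of a `(2i+1)`-linear form with the `2i`-component of the Chern character of `e`. -/
def chernTerm (i : ℕ) (ψ : Cochain A (2 * i)) (e : A) : ℂ :=
  chernCoeff i * (ψ (fun _ => e) -
    1 / 2 * (ψ (Fin.cons 1 fun _ => e) - ψ (cyc id (Fin.cons 1 fun _ => e))))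

theorem chernTerm_zero (ψ : Cochain A 0) (e : A) : chernTerm 0 ψ e = ψ (fun _ => e) := by
  have h : cyc id (Fin.cons 1 fun _ => e : Fin 1 → A) = Fin.cons 1 fun _ => e := by
    funext l
    have hl : l = 0 := Fin.fin_one_eq_zero l
    subst hl
    rfl
  change chernCoeff 0 * (ψ (fun _ => e) -
    1 / 2 * (ψ (Fin.cons 1 fun _ => e) - ψ (cyc id (Fin.cons 1 fun _ => e)))) = _
  rw [h]
  simp [chernCoeff]

theorem chernTerm_succ (i : ℕ) (ψ : Cochain A (2 * i + 1 + 1)) (e : A) :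
    chernTerm (i + 1) ψ e = chernCoeff (i + 1) *
      (ψ (fun _ => e) - 1 / 2 * extraDual (oneSubCyc .refl ψ) (fun _ => e)) := by
  rw [extraDual_apply, oneSubCyc_apply, Even.neg_one_pow ⟨i + 1, by ring⟩, one_mul]
  rfl

theorem chernTerm_add (i : ℕ) (ψ φ : Cochain A (2 * i)) (e : A) :
    chernTerm i (ψ + φ) e = chernTerm i ψ e + chernTerm i φ e := by
  simp only [chernTerm, add_apply]
  ring

theorem chernTerm_smul (i : ℕ) (c : ℂ) (φ : Cochain A (2 * i)) (e : A) :
    chernTerm i (c • φ) e = c * chernTerm i φ e := by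
  simp only [chernTerm, smul_apply, smul_eq_mul]
  ring

/-- The correction term sees a form only through 1 - τ, which annihilates the image of the norm, so
only the leading term contributes. -/
theorem chernTerm_BDual {e : A} (i : ℕ) (φ : Cochain A (2 * i + 1)) :
    chernTerm i (BDual .refl φ) e = chernCoeff i * ((2 * i + 1) *
      extraDual (oneSubCyc .refl φ) (fun _ => e)) := by
  rw [BDual_apply]
  cases i with
  | zero =>
    refine (chernTerm_zero _ e).trans ((normDual_const (n := 0) e Even.zero _).trans ?_)
    simp [chernCoeff]
  | succ i =>
    rw [chernTerm_succ, oneSubCyc_normDual]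
    erw [normDual_const (n := 2 * (i + 1)) e (even_two_mul _)]
    simp

/-- In odd degree 1 - (-1)ⁿτ doubles the value on a constant tuple, so half of it cancels the
leading term. What remains is the b' part of `extraDual_oneSubCyc_bDual`, which matches the B-term
by the coefficient recursion. -/
theorem chernTerm_bDual {e : A} (he : e * e = e) (i : ℕ) (φ : Cochain A (2 * i + 1)) :
    chernTerm (i + 1) (bDual .refl φ) e = -chernTerm i (BDual .refl φ) e := by
  rw [chernTerm_succ, chernTerm_BDual, extraDual_oneSubCyc_bDual, bDual_const he ⟨i, rfl⟩,
    sub_apply, bPrimeDual_const he ⟨i, by ring⟩, oneSubCyc_apply, cyc_refl_const,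
    Odd.neg_one_pow ⟨i, rfl⟩, chernCoeff_succ]
  ring

theorem sum_chernTerm_totalDiff {e : A} (he : e * e = e) (φ : ∀ m, Cochain A m) (n : ℕ) :
    ∑ i ∈ Finset.range (n + 1), chernTerm i (totalDiff .refl φ (2 * i)) e =
      chernTerm n (BDual .refl (φ (2 * n + 1))) e := by
  induction n with
  | zero => simp; rfl
  | succ n ih =>
    rw [Finset.sum_range_succ, ih]
    have h : chernTerm (n + 1) (totalDiff .refl φ (2 * (n + 1))) e =
        chernTerm (n + 1) (bDual .refl (φ (2 * n + 1))) e +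
          chernTerm (n + 1) (BDual .refl (φ (2 * (n + 1) + 1))) e :=
      chernTerm_add (n + 1) _ _ e
    rw [h, chernTerm_bDual he, add_neg_cancel_left]

end Idempotent

end Untwisted

/-! ### Tuples that are constant except for one entry. -/

section Words

variable {A : Type*} [Ring A] [Algebra ℂ A]

/-- The tuple `(e, …, e, y, e, …, e)` of length `n + 1` with `y` at position `l`. -/
def word (n : ℕ) (e : A) (l : ℕ) (y : A) : Fin (n + 1) → A := fun i => if (i : ℕ) = l then y else e

theorem word_eq_update {n : ℕ} (e : A) {l : ℕ} (hl : l < n + 1) (y : A) :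
    word n e l y = Function.update (fun _ => e) ⟨l, hl⟩ y := by
  funext i
  simp [word, Function.update_apply, Fin.ext_iff]

theorem map_word_add {n : ℕ} (φ : Cochain A n) (e : A) {l : ℕ} (hl : l < n + 1) (y z : A) :
    φ (word n e l (y + z)) = φ (word n e l y) + φ (word n e l z) := by
  simp only [word_eq_update e hl, φ.map_update_add]

theorem map_word_sub {n : ℕ} (φ : Cochain A n) (e : A) {l : ℕ} (hl : l < n + 1) (y z : A) :
    φ (word n e l (y - z)) = φ (word n e l y) - φ (word n e l z) := by
  simp only [word_eq_update e hl, φ.map_update_sub]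

theorem map_word_zero {n : ℕ} (φ : Cochain A n) (e : A) {l : ℕ} (hl : l < n + 1) :
    φ (word n e l 0) = 0 := by
  rw [word_eq_update e hl, φ.map_update_zero]

theorem face_word {e : A} (he : e * e = e) {n : ℕ} (j : Fin (n + 1)) (l : ℕ) (y : A) :
    face j (word (n + 1) e l y) =
      if (j : ℕ) + 1 < l then word n e (l - 1) y
      else if (j : ℕ) + 1 = l then word n e (l - 1) (e * y)
      else if (j : ℕ) = l then word n e l (y * e) else word n e l y := by
  funext i
  simp only [face, Fin.contractNth, word, Fin.val_castSucc, Fin.val_succ]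
  split_ifs <;> simp only [word] <;> split_ifs <;> first | rfl | omega

theorem sum_neg_one_pow_ite (l N : ℕ) (hl : l ≤ N) (x y : ℂ) :
    ∑ j ∈ Finset.range N, (-1 : ℂ) ^ j * (if j < l then x else y) =
      (if Even l then 0 else 1) * x +
        ((if Even N then 0 else 1) - (if Even l then 0 else 1)) * y := by
  have h : ∀ j, (-1 : ℂ) ^ j * (if j < l then x else y) =
      (-1 : ℂ) ^ j * y + if j < l then (-1 : ℂ) ^ j * (x - y) else 0 := by
    intro j
    split_ifs <;> ring
  have hf : (Finset.range N).filter (· < l) = Finset.range l := by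
    ext j
    simp
    omega
  simp only [h, Finset.sum_add_distrib, ← Finset.sum_filter, hf, ← Finset.sum_mul,
    neg_one_geom_sum]
  ring

/-- Faces before position l shift y one place left, later ones leave it in place. Face l forms ye =
0, so its contribution is subtracted, and it exists only for l < n+1. At l = 0 the truncated index l
- 1 has coefficient zero. -/
theorem bPrimeDual_word_left {e y : A} (he : e * e = e) (hy : e * y = y) (hy' : y * e = 0)
    {n : ℕ} (φ : Cochain A n) {l : ℕ} (hl : l ≤ n + 1) :
    bPrimeDual φ (word (n + 1) e l y) =
      (if Even l then 0 else 1) * φ (word n e (l - 1) y) +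
        ((if Even (n + 1) then 0 else 1) - (if Even l then 0 else 1)) * φ (word n e l y) -
        if l < n + 1 then (-1 : ℂ) ^ l * φ (word n e l y) else 0 := by
  have h : ∀ j : Fin (n + 1), (-1 : ℂ) ^ (j : ℕ) * φ (face j (word (n + 1) e l y)) =
      (-1 : ℂ) ^ (j : ℕ) * (if (j : ℕ) < l then φ (word n e (l - 1) y) else φ (word n e l y)) -
        if (j : ℕ) = l then (-1 : ℂ) ^ l * φ (word n e l y) else 0 := by
    intro j
    have hj := j.isLt
    rw [face_word he, hy, hy']
    rcases lt_trichotomy (j : ℕ) l with h | h | h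
    · rcases (Nat.succ_le_of_lt h).lt_or_eq with h1 | h1
      · rw [if_pos h1, if_pos h, if_neg h.ne, sub_zero]
      · rw [if_neg (by omega), if_pos h1, if_pos h, if_neg h.ne, sub_zero]
    · rw [if_neg (by omega), if_neg (by omega), if_pos h, if_neg (by omega), if_pos h,
        map_word_zero φ e (by omega), h]
      ring
    · rw [if_neg (by omega), if_neg (by omega), if_neg h.ne', if_neg (by omega), if_neg h.ne',
        sub_zero]
  rw [bPrimeDual_apply]
  simp only [h, Finset.sum_sub_distrib]
  rw [Fin.sum_univ_eq_sum_range (fun j => (-1 : ℂ) ^ j *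
      (if j < l then φ (word n e (l - 1) y) else φ (word n e l y))),
    Fin.sum_univ_eq_sum_range (fun j => if j = l then (-1 : ℂ) ^ l * φ (word n e l y) else 0),
    sum_neg_one_pow_ite l _ hl]
  simp

/-- Here the missing face is number l - 1, which forms ey = 0; it is absent for l = 0. -/
theorem bPrimeDual_word_right {e y : A} (he : e * e = e) (hy : e * y = 0) (hy' : y * e = y)
    {n : ℕ} (φ : Cochain A n) {l : ℕ} (hl : l ≤ n + 1) :
    bPrimeDual φ (word (n + 1) e l y) =
      (if Even l then 0 else 1) * φ (word n e (l - 1) y) +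
        ((if Even (n + 1) then 0 else 1) - (if Even l then 0 else 1)) * φ (word n e l y) -
        if 0 < l then (-1 : ℂ) ^ (l - 1) * φ (word n e (l - 1) y) else 0 := by
  have h : ∀ j : Fin (n + 1), (-1 : ℂ) ^ (j : ℕ) * φ (face j (word (n + 1) e l y)) =
      (-1 : ℂ) ^ (j : ℕ) * (if (j : ℕ) < l then φ (word n e (l - 1) y) else φ (word n e l y)) -
        if (j : ℕ) + 1 = l then (-1 : ℂ) ^ (l - 1) * φ (word n e (l - 1) y) else 0 := by
    intro j
    have hj := j.isLt
    rw [face_word he, hy, hy']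
    rcases lt_trichotomy ((j : ℕ) + 1) l with h | h | h
    · rw [if_pos h, if_pos (by omega), if_neg h.ne, sub_zero]
    · rw [if_neg (by omega), if_pos h, if_pos (by omega), if_pos h,
        map_word_zero φ e (by omega), ← h]
      simp
    · rw [if_neg (by omega), if_neg (by omega), ite_self, if_neg (by omega), if_neg (by omega),
        sub_zero]
  rw [bPrimeDual_apply]
  simp only [h, Finset.sum_sub_distrib]
  rw [Fin.sum_univ_eq_sum_range (fun j => (-1 : ℂ) ^ j *
      (if j < l then φ (word n e (l - 1) y) else φ (word n e l y))),
    Fin.sum_univ_eq_sum_range (fun j => if j + 1 = l then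
      (-1 : ℂ) ^ (l - 1) * φ (word n e (l - 1) y) else 0),
    sum_neg_one_pow_ite l _ hl]
  congr 1
  rcases l with _ | l
  · simp
  · simp only [add_left_inj]
    rw [Finset.sum_ite_eq' (Finset.range (n + 1)), if_pos (by simpa using hl), if_pos l.succ_pos]

theorem cyc_word (e : A) {n l : ℕ} (hl : l < n) (y : A) :
    cyc (AlgEquiv.refl : A ≃ₐ[ℂ] A) (word n e l y) = word n e (l + 1) y := by
  funext i
  refine Fin.cases ?_ (fun i => ?_) i
  · simp [cyc, word, hl.ne']
  · simp [cyc, word]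

theorem cyc_iterate_word (e : A) {n l : ℕ} (hl : l ≤ n) (y : A) :
    (cyc (AlgEquiv.refl : A ≃ₐ[ℂ] A))^[l] (word n e 0 y) = word n e l y := by
  induction l with
  | zero => rfl
  | succ l ih => rw [Function.iterate_succ_apply', ih (by omega), cyc_word e (by omega)]

theorem normDual_word (e : A) {n : ℕ} (hn : Odd n) (φ : Cochain A n) (y : A) :
    normDual .refl φ (word n e 0 y) =
      ∑ l ∈ Finset.range (n + 1), (-1 : ℂ) ^ l * φ (word n e l y) := by
  rw [normDual_apply]
  refine Finset.sum_congr rfl fun l hl => ?_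
  rw [cyc_iterate_word e (by simpa [Nat.lt_succ_iff] using hl), pow_mul, hn.neg_one_pow]

theorem lastFace_word_zero (e : A) {n : ℕ} (y : A) :
    lastFace (AlgEquiv.refl : A ≃ₐ[ℂ] A) (word (n + 1) e 0 y) = word n e 0 (e * y) := by
  funext i
  refine Fin.cases ?_ (fun i => ?_) i
  · simp [lastFace, word]
  · simp [lastFace, word]

/-- Only the zeroth face and the wrap-around face touch y, giving ye and ey; the n remaining faces
cancel in pairs because n is even. So b acts on such words as a commutator with e. -/
theorem bDual_word_zero {e : A} (he : e * e = e) {n : ℕ} (hn : Even n) (φ : Cochain A n) (y : A) :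
    bDual .refl φ (word (n + 1) e 0 y) = φ (word n e 0 (y * e - e * y)) := by
  have h : ∀ j : Fin (n + 1), (-1 : ℂ) ^ (j : ℕ) * φ (face j (word (n + 1) e 0 y)) =
      (-1 : ℂ) ^ (j : ℕ) *
        if (j : ℕ) < 1 then φ (word n e 0 (y * e)) else φ (word n e 0 y) := by
    intro j
    rw [face_word he, if_neg (by omega), if_neg (by omega)]
    rcases Nat.eq_zero_or_pos (j : ℕ) with h | h
    · rw [if_pos h, if_pos (by omega)]
    · rw [if_neg (by omega), if_neg (by omega)]
  rw [bDual_apply, lastFace_word_zero, map_word_sub φ e (by omega)]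
  simp only [h]
  rw [Fin.sum_univ_eq_sum_range (fun j => (-1 : ℂ) ^ j *
      if j < 1 then φ (word n e 0 (y * e)) else φ (word n e 0 y)),
    sum_neg_one_pow_ite 1 _ (by omega), if_neg (by decide), if_neg (by grind),
    Odd.neg_one_pow (by grind)]
  ring

/-- The function is a polynomial in t. Expanding multilinearly around the given point, terms with at
least two factors f vanish to second order. -/
theorem hasDerivAt_map_const {n : ℕ} (φ : Cochain A n) (e f : A) (t : ℂ) :
    HasDerivAt (fun t : ℂ => φ (fun _ => e + t • f))
      (∑ l ∈ Finset.range (n + 1), φ (word n (e + t • f) l f)) t := by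
  set a : Fin (n + 1) → A := fun _ => e + t • f with ha
  let c : Finset (Fin (n + 1)) → ℂ := fun s => φ (s.piecewise (fun _ => f) a)
  have hD : φ.linearDeriv a (fun _ => f) =
      ∑ l ∈ Finset.range (n + 1), φ (word n (e + t • f) l f) := by
    rw [MultilinearMap.linearDeriv_apply,
      ← Fin.sum_univ_eq_sum_range (fun l => φ (word n (e + t • f) l f))]
    exact Finset.sum_congr rfl fun l _ => by rw [word_eq_update _ l.isLt]
  have hs : ∀ (u : ℂ) (s : Finset (Fin (n + 1))),
      φ (s.piecewise (fun _ => u • f) a) = u ^ s.card * c s := by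
    intro u s
    have h := φ.map_piecewise_smul (fun _ => u) (s.piecewise (fun _ => f) a) s
    rw [Finset.prod_const, smul_eq_mul] at h
    rw [← h]
    congr 1
    funext i
    by_cases hi : i ∈ s <;> simp [hi]
  have hexp : (fun u : ℂ => φ (fun _ => e + u • f)) = fun u => φ a +
      (u - t) * (∑ l ∈ Finset.range (n + 1), φ (word n (e + t • f) l f)) +
        ∑ s : Finset (Fin (n + 1)) with 2 ≤ s.card, (u - t) ^ s.card * c s := by
    funext u
    have h1 : (fun _ : Fin (n + 1) => e + u • f) = a + (u - t) • fun _ => f := by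
      funext i
      simp only [ha, Pi.add_apply, Pi.sub_apply, Pi.smul_apply, sub_smul]
      abel
    rw [h1, φ.map_add_eq_map_add_linearDeriv_add, map_smul, hD, smul_eq_mul]
    congr 1
    exact Finset.sum_congr rfl fun s _ => hs _ s
  rw [hexp]
  have hid : HasDerivAt (fun u : ℂ => u - t) 1 t := (hasDerivAt_id t).sub_const t
  have h2 : HasDerivAt (fun u : ℂ => ∑ s : Finset (Fin (n + 1)) with 2 ≤ s.card,
      (u - t) ^ s.card * c s) (∑ s : Finset (Fin (n + 1)) with 2 ≤ s.card, 0) t := by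
    refine HasDerivAt.fun_sum fun s hs => ?_
    have h := (hid.fun_pow s.card).mul_const (c s)
    have hc : s.card - 1 ≠ 0 := by
      have := (Finset.mem_filter.mp hs).2
      omega
    simpa [hc] using h
  have h3 := ((hid.mul_const (∑ l ∈ Finset.range (n + 1),
    φ (word n (e + t • f) l f))).const_add (φ a)).fun_add h2
  simpa using h3

end Words

/-! ### Homotopy invariance along lines of idempotents. -/

section Homotopy

variable {A : Type*} [Ring A] [Algebra ℂ A]

/-- Summation by parts. It trades N + 1 copies of the value with f in position 0 for the sum over
all positions, which is the derivative. -/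
theorem sum_weighted_telescope (a : ℕ → ℂ) (N : ℕ) :
    ∑ l ∈ Finset.range N, ((N : ℂ) - l) * (a l - a (l + 1)) =
      (N + 1) * a 0 - ∑ l ∈ Finset.range (N + 1), a l := by
  induction N with
  | zero => simp
  | succ N ih =>
    have h : ∀ l ∈ Finset.range (N + 1), (((N + 1 : ℕ) : ℂ) - l) * (a l - a (l + 1)) =
        ((N : ℂ) - l) * (a l - a (l + 1)) + (a l - a (l + 1)) := by
      intro l _
      push_cast
      ring
    rw [Finset.sum_congr rfl h, Finset.sum_add_distrib, Finset.sum_range_succ, ih,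
      Finset.sum_range_sub', Finset.sum_range_succ _ (N + 1)]
    push_cast
    ring

/-- The numerical core of `transgressionCorrection_bPrimeDual`: x and r are the values of a form on
words with entry ef and fe at position l, and b is the value of its b'-coboundary on the word with
entry f. -/
theorem sum_weighted_alternating (x r b : ℕ → ℂ) (q : ℕ) (h0 : b 0 = -x 0)
    (he : ∀ p < q, b (2 * p + 2) = -x (2 * p + 2) + r (2 * p + 1))
    (ho : ∀ p ≤ q, b (2 * p + 1) = x (2 * p) - r (2 * p + 1)) :
    ∑ l ∈ Finset.range (2 * q + 2), ((2 * q + 2 : ℂ) - l) * b l =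
      -∑ l ∈ Finset.range (2 * q + 2), if Even l then x l else r l := by
  -- The induction runs over pairs of positions; stopping early leaves a defect proportional to q -
  -- p, which disappears at p = q.
  have key : ∀ p ≤ q, ∑ l ∈ Finset.range (2 * p + 2), ((2 * q + 2 : ℂ) - l) * b l =
      -(∑ l ∈ Finset.range (2 * p + 2), if Even l then x l else r l) -
        2 * ((q : ℂ) - p) * r (2 * p + 1) := by
    intro p hp
    induction p with
    | zero =>
      have h1 := ho 0 (Nat.zero_le q)
      simp only [mul_zero, zero_add] at h1
      simp [Finset.sum_range_succ, h0, h1]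
      ring
    | succ p ih =>
      have e1 : Even (2 * p + 2) := by grind
      have e2 : ¬ Even (2 * p + 3) := by grind
      have h1 := ho (p + 1) hp
      rw [Nat.mul_succ] at h1 ⊢
      rw [Finset.sum_range_succ, Finset.sum_range_succ, ih (by omega), he p (by omega), h1,
        Finset.sum_range_succ _ (2 * p + 2 + 1), Finset.sum_range_succ _ (2 * p + 2), if_pos e1,
        if_neg e2]
      push_cast
      ring
  simpa using key q le_rfl

/-- `e + t f` is an idempotent for all `t`. -/
structure IsIdempotentLine (e f : A) : Prop where
  idem : e * e = e
  anti : e * f + f * e = f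
  sq : f * f = 0

namespace IsIdempotentLine

variable {e f : A} (h : IsIdempotentLine e f)
include h

theorem mul_mul_eq_zero : e * f * e = 0 := by
  have h1 := congrArg (e * ·) h.anti
  simp only [mul_add, ← mul_assoc, h.idem] at h1
  simpa using h1

theorem add_smul (t : ℂ) : IsIdempotentLine (e + t • f) f where
  idem := by
    have : (e + t • f) * (e + t • f) = e * e + t • (e * f + f * e) + (t * t) • (f * f) := by
      simp only [mul_add, add_mul, smul_mul_assoc, mul_smul_comm, smul_smul, smul_add]
      abel
    rw [this, h.idem, h.anti, h.sq, smul_zero, add_zero]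
  anti := by
    simp only [mul_add, add_mul, smul_mul_assoc, mul_smul_comm, h.sq, smul_zero, add_zero, h.anti]
  sq := h.sq

end IsIdempotentLine

/-- The `l`-th entry of the word `∑ₗ (e, …, yₗ, …, e)` annihilated by `b'`. -/
def altEntry (e f : A) (l : ℕ) : A := if Even l then e * f else f * e

/-- The correction term in the transgression of the Chern character. -/
def transgressionCorrection (e f : A) {q : ℕ} (χ : Cochain A (2 * q + 2)) : ℂ :=
  -∑ l ∈ Finset.range (2 * q + 2), ((2 * q + 2 : ℂ) - l) * χ (word (2 * q + 2) e l f) -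
    ∑ l ∈ Finset.range (2 * q + 2), extraDual χ (word (2 * q + 1) e l (altEntry e f l))

/-- The two sums in the correction are matched for this purpose. On the alternating words the
contraction `extraDual_bPrimeDual` leaves just χ, because b' vanishes there. Splitting f = ef + fe,
the weighted sum yields the same values with the opposite sign. -/
theorem transgressionCorrection_bPrimeDual {e f : A} (h : IsIdempotentLine e f) {q : ℕ}
    (χ : Cochain A (2 * q + 1)) : transgressionCorrection e f (bPrimeDual χ) = 0 := by
  have he := h.idem
  have hl1 : e * (e * f) = e * f := by rw [← mul_assoc, he]
  have hl2 : e * f * e = 0 := h.mul_mul_eq_zero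
  have hr1 : e * (f * e) = 0 := by rw [← mul_assoc, hl2]
  have hr2 : f * e * e = f * e := by rw [mul_assoc, he]
  have h1 : ∀ l ∈ Finset.range (2 * q + 2),
      extraDual (bPrimeDual χ) (word (2 * q + 1) e l (altEntry e f l)) =
        χ (word (2 * q + 1) e l (altEntry e f l)) := by
    intro l hl
    rw [Finset.mem_range] at hl
    rw [extraDual_bPrimeDual, sub_apply, sub_eq_self]
    have hodd : ¬ Even (2 * q + 1) := by grind
    unfold altEntry
    split_ifs with hev
    · have : l < 2 * q + 1 := by grind
      rw [bPrimeDual_word_left he hl1 hl2 _ (by omega), if_pos hev, if_neg hodd, if_pos this,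
        hev.neg_one_pow]
      ring
    · rw [bPrimeDual_word_right he hr1 hr2 _ (by omega), if_neg hev, if_neg hodd,
        if_pos (by grind), Even.neg_one_pow (by grind)]
      ring
  have hN : Even (2 * q + 1 + 1) := by grind
  have h2 : ∀ l ∈ Finset.range (2 * q + 2), bPrimeDual χ (word (2 * q + 2) e l f) =
      bPrimeDual χ (word (2 * q + 2) e l (e * f)) + bPrimeDual χ (word (2 * q + 2) e l (f * e)) := by
    intro l hl
    rw [Finset.mem_range] at hl
    rw [← map_word_add _ _ (by omega), h.anti]
  have h3 := sum_weighted_alternating (fun l => χ (word (2 * q + 1) e l (e * f)))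
    (fun l => χ (word (2 * q + 1) e l (f * e)))
    (fun l => bPrimeDual χ (word (2 * q + 2) e l (e * f)) +
      bPrimeDual χ (word (2 * q + 2) e l (f * e))) q
    (by
      rw [bPrimeDual_word_left he hl1 hl2 _ (by omega),
        bPrimeDual_word_right he hr1 hr2 _ (by omega)]
      simp [hN])
    (by
      intro p hp
      have hev : Even (2 * p + 2) := by grind
      rw [bPrimeDual_word_left he hl1 hl2 _ (by omega),
        bPrimeDual_word_right he hr1 hr2 _ (by omega), if_pos hev, if_pos hN, if_pos (by omega),
        if_pos (by omega), hev.neg_one_pow, Odd.neg_one_pow (by grind)]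
      simp)
    (by
      intro p hp
      have hev : ¬ Even (2 * p + 1) := by grind
      rw [bPrimeDual_word_left he hl1 hl2 _ (by omega),
        bPrimeDual_word_right he hr1 hr2 _ (by omega), if_neg hev, if_pos hN, if_pos (by omega),
        if_pos (by omega), Odd.neg_one_pow (by grind), Even.neg_one_pow (by grind)]
      simp
      ring)
  rw [transgressionCorrection, Finset.sum_congr rfl h1,
    Finset.sum_congr rfl fun l hl => by rw [h2 l hl], h3]
  have h4 : ∀ l, χ (word (2 * q + 1) e l (altEntry e f l)) = if Even l then
      χ (word (2 * q + 1) e l (e * f)) else χ (word (2 * q + 1) e l (f * e)) := by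
    intro l
    unfold altEntry
    split_ifs <;> rfl
  simp only [h4]
  ring

/-- The pairing of a `2i+2`-linear form with the transgression of the Chern character along the
line of idempotents `e + t f`. -/
def transgression (e f : A) : (i : ℕ) → Cochain A (2 * i + 1) → ℂ
  | 0, φ => φ (word 1 e 0 (f * e - e * f))
  | i + 1, φ => chernCoeff (i + 1) *
      ((2 * i + 3) * φ (word (2 * i + 3) e 0 (f * e - e * f)) +
        transgressionCorrection e f (q := i) (extraDual (oneSubCyc .refl φ)))

theorem transgressionCorrection_add (e f : A) {q : ℕ} (χ χ' : Cochain A (2 * q + 2)) :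
    transgressionCorrection e f (χ + χ') =
      transgressionCorrection e f χ + transgressionCorrection e f χ' := by
  simp only [transgressionCorrection, map_add, add_apply, mul_add, Finset.sum_add_distrib]
  ring

theorem transgressionCorrection_zero (e f : A) {q : ℕ} :
    transgressionCorrection e f (0 : Cochain A (2 * q + 2)) = 0 := by
  simp [transgressionCorrection]

theorem transgression_add (e f : A) (i : ℕ) (φ φ' : Cochain A (2 * i + 1)) :
    transgression e f i (φ + φ') = transgression e f i φ + transgression e f i φ' := by
  cases i with
  | zero => rfl
  | succ i =>
    simp only [transgression, map_add, transgressionCorrection_add, add_apply]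
    ring

theorem transgression_zero (e f : A) (i : ℕ) :
    transgression e f i (0 : Cochain A (2 * i + 1)) = 0 := by
  simpa using transgression_add e f i 0 0

/-- The line moves e infinitesimally by the inner derivation of fe - ef, which is why this element
is inserted in the transgression. -/
theorem commutator_word {e f : A} (h : IsIdempotentLine e f) :
    (f * e - e * f) * e - e * (f * e - e * f) = f := by
  rw [sub_mul, mul_sub, ← mul_assoc, ← mul_assoc, h.mul_mul_eq_zero, h.idem, mul_assoc, h.idem]
  conv_rhs => rw [← h.anti]
  abel

/-- By `extraDual_oneSubCyc_bDual` the argument of the correction is (1-τ)ψ up to a b'-coboundary,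
which the correction does not see. -/
theorem transgression_bDual_succ {e f : A} (h : IsIdempotentLine e f) (q : ℕ)
    (ψ : Cochain A (2 * q + 1 + 1)) :
    transgression e f (q + 1) (bDual .refl ψ) = chernCoeff (q + 1) *
      ((2 * q + 3) * ψ (word (2 * q + 2) e 0 f) +
        transgressionCorrection e f (oneSubCyc .refl ψ)) := by
  have h1 : bDual .refl ψ (word (2 * q + 3) e 0 (f * e - e * f)) = ψ (word (2 * q + 2) e 0 f) := by
    rw [bDual_word_zero h.idem (by grind), commutator_word h]
  have h2 := transgressionCorrection_add e f
    (oneSubCyc .refl ψ - bPrimeDual (extraDual (oneSubCyc .refl ψ)))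
    (bPrimeDual (extraDual (oneSubCyc .refl ψ)))
  rw [sub_add_cancel, transgressionCorrection_bPrimeDual h, add_zero] at h2
  rw [h2, ← h1, ← extraDual_oneSubCyc_bDual]
  rfl

theorem transgression_BDual (e f : A) (i : ℕ) (ψ : Cochain A (2 * i + 1 + 1)) :
    transgression e f i (BDual .refl ψ) = chernCoeff i * ((2 * i + 1) *
      ∑ l ∈ Finset.range (2 * i + 2), (-1 : ℂ) ^ l *
        extraDual (oneSubCyc .refl ψ) (word (2 * i + 1) e l (f * e - e * f))) := by
  rw [← normDual_word e ⟨i, rfl⟩, BDual_apply]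
  cases i with
  | zero =>
    simp [transgression, chernCoeff]
  | succ i =>
    rw [transgression, oneSubCyc_normDual, map_zero, transgressionCorrection_zero]
    have e1 : 2 * ((i + 1 : ℕ) : ℂ) + 1 = 2 * i + 3 := by
      push_cast
      ring
    rw [e1, add_zero]
    rfl

/-- The Cartan formula. The b-part gives the full derivative of the leading term plus an unwanted
sum over alternating words. The B-part, where (-1)^l(fe - ef) equals f minus twice the alternating
entry, cancels that sum and supplies the derivative of the ½-term. -/
theorem transgression_bDual_add_BDual {e f : A} (h : IsIdempotentLine e f) (q : ℕ)
    (ψ : Cochain A (2 * q + 1 + 1)) :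
    transgression e f (q + 1) (bDual .refl ψ) + transgression e f q (BDual .refl ψ) =
      chernCoeff (q + 1) * (∑ l ∈ Finset.range (2 * q + 3), ψ (word (2 * q + 2) e l f) -
        1 / 2 * ∑ l ∈ Finset.range (2 * q + 2),
          extraDual (oneSubCyc .refl ψ) (word (2 * q + 1) e l f)) := by
  set G := extraDual (oneSubCyc .refl ψ) with hG
  have h1 : ∀ l ∈ Finset.range (2 * q + 2), ((2 * q + 2 : ℂ) - l) *
      oneSubCyc .refl ψ (word (2 * q + 2) e l f) = (((2 * q + 2 : ℕ) : ℂ) - l) *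
        (ψ (word (2 * q + 2) e l f) - ψ (word (2 * q + 2) e (l + 1) f)) := by
    intro l hl
    rw [Finset.mem_range] at hl
    rw [oneSubCyc_apply, cyc_word e hl, Even.neg_one_pow (by grind)]
    push_cast
    ring
  have h2 : ∀ l ∈ Finset.range (2 * q + 2), (-1 : ℂ) ^ l *
      G (word (2 * q + 1) e l (f * e - e * f)) = G (word (2 * q + 1) e l f) -
        2 * G (word (2 * q + 1) e l (altEntry e f l)) := by
    intro l hl
    rw [Finset.mem_range] at hl
    have h3 := map_word_add G e hl (e * f) (f * e)
    rw [h.anti] at h3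
    rw [map_word_sub G e hl, h3]
    unfold altEntry
    split_ifs with hev
    · rw [hev.neg_one_pow]
      ring
    · rw [(Nat.not_even_iff_odd.mp hev).neg_one_pow]
      ring
  rw [transgression_bDual_succ h, transgression_BDual, transgressionCorrection, ← hG,
    Finset.sum_congr rfl h1, Finset.sum_congr rfl h2, sum_weighted_telescope,
    Finset.sum_sub_distrib, ← Finset.mul_sum, chernCoeff_succ]
  push_cast
  ring

theorem hasDerivAt_chernTerm_succ {e f : A} (h : IsIdempotentLine e f) (q : ℕ)
    (ψ : Cochain A (2 * q + 1 + 1)) (t : ℂ) :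
    HasDerivAt (fun t : ℂ => chernTerm (q + 1) ψ (e + t • f))
      (transgression (e + t • f) f (q + 1) (bDual .refl ψ) +
        transgression (e + t • f) f q (BDual .refl ψ)) t := by
  rw [transgression_bDual_add_BDual (h.add_smul t)]
  simp only [chernTerm_succ]
  exact ((hasDerivAt_map_const ψ e f t).fun_sub
    ((hasDerivAt_map_const _ e f t).const_mul (1 / 2))).const_mul _

theorem hasDerivAt_chernTerm_zero {e f : A} (h : IsIdempotentLine e f)
    (ψ : Cochain A 0) (t : ℂ) :
    HasDerivAt (fun t : ℂ => chernTerm 0 ψ (e + t • f))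
      (transgression (e + t • f) f 0 (bDual .refl ψ)) t := by
  simp only [chernTerm_zero]
  have h1 : transgression (e + t • f) f 0 (bDual .refl ψ) = ψ (word 0 (e + t • f) 0 f) := by
    rw [transgression, bDual_word_zero (h.add_smul t).idem Even.zero,
      commutator_word (h.add_smul t)]
  rw [h1]
  simpa using hasDerivAt_map_const ψ e f t

/-- The cocycle equation in degree 2n+1 cancels neighbouring transgressions, leaving only the one
from the top degree. -/
theorem hasDerivAt_sum_chernTerm {e f : A} (h : IsIdempotentLine e f)
    (ψ : ∀ m, Cochain A m) (hψ : totalDiff .refl ψ = 0) (t : ℂ) (n : ℕ) :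
    HasDerivAt (fun t : ℂ => ∑ i ∈ Finset.range (n + 1), chernTerm i (ψ (2 * i)) (e + t • f))
      (transgression (e + t • f) f n (bDual .refl (ψ (2 * n)))) t := by
  induction n with
  | zero => simpa using hasDerivAt_chernTerm_zero h (ψ 0) t
  | succ n ih =>
    have h1 : bDual .refl (ψ (2 * n)) + BDual .refl (ψ (2 * n + 1 + 1)) = 0 :=
      congrFun hψ (2 * n + 1)
    have h2 := transgression_add (e + t • f) f n (bDual .refl (ψ (2 * n)))
      (BDual .refl (ψ (2 * n + 1 + 1)))
    rw [h1, transgression_zero] at h2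
    have h3 := ih.fun_add (hasDerivAt_chernTerm_succ h n (ψ (2 * n + 1 + 1)) t)
    simp only [Finset.sum_range_succ _ (n + 1)]
    refine h3.congr_deriv ?_
    change _ = transgression (e + t • f) f (n + 1) (bDual .refl (ψ (2 * n + 1 + 1)))
    linear_combination -h2

theorem sum_chernTerm_line {e f : A} (h : IsIdempotentLine e f)
    (ψ : ∀ m, Cochain A m) (hψ : totalDiff .refl ψ = 0) {n : ℕ} (hn : ψ (2 * n + 2) = 0) :
    ∑ i ∈ Finset.range (n + 1), chernTerm i (ψ (2 * i)) (e + f) =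
      ∑ i ∈ Finset.range (n + 1), chernTerm i (ψ (2 * i)) e := by
  have h1 : bDual .refl (ψ (2 * n)) + BDual .refl (ψ (2 * n + 2)) = 0 :=
    congrFun hψ (2 * n + 1)
  rw [hn, map_zero, add_zero] at h1
  have h2 : ∀ t, HasDerivAt
      (fun t : ℂ => ∑ i ∈ Finset.range (n + 1), chernTerm i (ψ (2 * i)) (e + t • f)) 0 t := by
    intro t
    have h3 := hasDerivAt_sum_chernTerm h ψ hψ t n
    rwa [h1, transgression_zero] at h3
  have h3 := is_const_of_deriv_eq_zero (fun t => (h2 t).differentiableAt) (fun t => (h2 t).deriv) 1 0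
  simpa using h3

/-- The path p, p + w, q + v, q consists of three idempotent lines: consecutive idempotents x, y
satisfy either xy = y, yx = x (same image) or xy = x, yx = y (same kernel), and either condition
makes (y - x)² = 0 and the whole segment idempotent. -/
theorem sum_chernTerm_eq_of_equiv {p q v w : A} (hp : p * p = p) (hq : q * q = q)
    (hpq : p * q = 0) (hqp : q * p = 0) (hwv : w * v = p) (hvw : v * w = q)
    (ψ : ∀ m, Cochain A m) (hψ : totalDiff .refl ψ = 0) {n : ℕ} (hn : ψ (2 * n + 2) = 0) :
    ∑ i ∈ Finset.range (n + 1), chernTerm i (ψ (2 * i)) p =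
      ∑ i ∈ Finset.range (n + 1), chernTerm i (ψ (2 * i)) q := by
  -- Compressing v and w by p and q makes them genuine partial isomorphisms, so orthogonality of p
  -- and q forces all the other products to vanish.
  obtain ⟨v, w, hwv, hvw, hqv, hvp, hpw, hwq⟩ : ∃ v w : A, w * v = p ∧ v * w = q ∧
      q * v = v ∧ v * p = v ∧ p * w = w ∧ w * q = w := by
    refine ⟨q * v * p, p * w * q, ?_, ?_, ?_, ?_, ?_, ?_⟩
    · calc p * w * q * (q * v * p) = p * w * (q * q) * v * p := by simp only [mul_assoc]
        _ = p * (w * v) * (w * v) * p := by rw [hq, ← hvw]; simp only [mul_assoc]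
        _ = p := by rw [hwv, hp, hp, hp]
    · calc q * v * p * (p * w * q) = q * v * (p * p) * w * q := by simp only [mul_assoc]
        _ = q * (v * w) * (v * w) * q := by rw [hp, ← hwv]; simp only [mul_assoc]
        _ = q := by rw [hvw, hq, hq, hq]
    · simp only [← mul_assoc, hq]
    · simp only [mul_assoc, hp]
    · simp only [← mul_assoc, hp]
    · simp only [mul_assoc, hq]
  have hpv : p * v = 0 := by rw [← hqv, ← mul_assoc, hpq, zero_mul]
  have hvq : v * q = 0 := by rw [← hvp, mul_assoc, hpq, mul_zero]
  have hqw : q * w = 0 := by rw [← hpw, ← mul_assoc, hqp, zero_mul]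
  have hwp : w * p = 0 := by rw [← hwq, mul_assoc, hqp, mul_zero]
  have hvv : v * v = 0 := by rw [← hqv, ← mul_assoc, mul_assoc q, mul_assoc, hvq]; simp
  have hww : w * w = 0 := by rw [← hpw, ← mul_assoc, mul_assoc p, hwp]; simp
  have h1 : IsIdempotentLine p w := ⟨hp, by simp [hpw, hwp], hww⟩
  have h2 : IsIdempotentLine (p + w) (v + q - p - w) := by
    constructor
    · simp [mul_add, add_mul, *]
    · simp only [mul_add, add_mul, mul_sub, sub_mul, *]
      abel
    · simp only [mul_add, add_mul, mul_sub, sub_mul, *]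
      abel
  have h3 : IsIdempotentLine q v := ⟨hq, by simp [hqv, hvq], hvv⟩
  have e : p + w + (v + q - p - w) = q + v := by abel
  rw [← sum_chernTerm_line h1 ψ hψ hn, ← sum_chernTerm_line h2 ψ hψ hn, e,
    sum_chernTerm_line h3 ψ hψ hn]

end Homotopy

/-! ### Removing the twist by a weighted trace on covariant matrices. -/

section TraceForm

variable {B : Type*} [Ring B] [Algebra ℂ B] {ι κ : Type*} [Fintype ι] [DecidableEq ι]
  [Fintype κ] [DecidableEq κ]

/-- The extension of an `(n+1)`-linear form on `B` to matrices over `B` by the trace twisted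
with the scalar matrix `K`. -/
def traceForm (K : Matrix ι ι ℂ) {n : ℕ} : Cochain B n →ₗ[ℂ] Cochain (Matrix ι ι B) n :=
  ∑ j : Fin (n + 2) → ι, K (j (Fin.last (n + 1))) (j 0) •
    MultilinearMap.compLinearMapₗ fun i : Fin (n + 1) =>
      Matrix.entryLinearMap ℂ B (j i.castSucc) (j i.succ)

theorem traceForm_apply (K : Matrix ι ι ℂ) {n : ℕ} (φ : Cochain B n)
    (a : Fin (n + 1) → Matrix ι ι B) :
    traceForm K φ a = ∑ j : Fin (n + 2) → ι, K (j (Fin.last (n + 1))) (j 0) *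
      φ (fun i => a i (j i.castSucc) (j i.succ)) := by
  rw [traceForm, LinearMap.sum_apply, sum_apply]
  rfl

theorem insertNth_castSucc {n : ℕ} (p : Fin (n + 1)) (l : ι) (j : Fin n → ι) (y : Fin n)
    (h : (y : ℕ) < p) : (p.insertNth l j : Fin (n + 1) → ι) y.castSucc = j y := by
  rw [← Fin.succAbove_of_castSucc_lt p y h, Fin.insertNth_apply_succAbove]

theorem insertNth_succ {n : ℕ} (p : Fin (n + 1)) (l : ι) (j : Fin n → ι) (y : Fin n)
    (h : (p : ℕ) ≤ y) : (p.insertNth l j : Fin (n + 1) → ι) y.succ = j y := by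
  rw [← Fin.succAbove_of_le_castSucc p y h, Fin.insertNth_apply_succAbove]

theorem sum_insertNth {R : Type*} [AddCommMonoid R] {n : ℕ} (p : Fin (n + 1))
    (F : (Fin (n + 1) → ι) → R) :
    ∑ j, F j = ∑ j : Fin n → ι, ∑ l : ι, F (p.insertNth l j) := by
  rw [← (Fin.insertNthEquiv (fun _ => ι) p).sum_comp, Fintype.sum_prod_type, Finset.sum_comm]
  rfl

/-- The index between the entries i and i+1 occurs only in their product; summing over it produces
the matrix product. -/
theorem traceForm_faceDual (K : Matrix ι ι ℂ) {n : ℕ} (i : Fin (n + 1)) (φ : Cochain B n)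
    (a : Fin (n + 2) → Matrix ι ι B) :
    traceForm K (faceDual i φ) a = traceForm K φ (face i a) := by
  rw [traceForm_apply, traceForm_apply, sum_insertNth i.succ.castSucc]
  refine Finset.sum_congr rfl fun j _ => ?_
  let b : Fin (n + 1) → B := fun i' => face i a i' (j i'.castSucc) (j i'.succ)
  have hb : b = Function.update b i (∑ l : ι,
      a i.castSucc (j i.castSucc) l * a i.succ l (j i.succ)) := by
    rw [Function.eq_update_self_iff]
    simp [b, face, Fin.contractNth, Matrix.mul_apply]
  have hl : ∀ l : ι, face i (fun i' => a i'
      ((i.succ.castSucc.insertNth l j : Fin (n + 3) → ι) i'.castSucc)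
      ((i.succ.castSucc.insertNth l j : Fin (n + 3) → ι) i'.succ)) =
      Function.update b i (a i.castSucc (j i.castSucc) l * a i.succ l (j i.succ)) := by
    intro l
    have hp : (i.succ.castSucc.insertNth l j : Fin (n + 3) → ι) i.succ.castSucc = l :=
      Fin.insertNth_apply_same _ _ _
    funext k
    rcases lt_trichotomy k i with h | h | h
    · have h1 : (k : ℕ) < i := h
      rw [Function.update_of_ne h.ne]
      simp only [face, Fin.contractNth, Fin.val_castSucc, if_pos h1, b]
      rw [insertNth_castSucc _ _ _ _ (by simp; omega), Fin.succ_castSucc,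
        insertNth_castSucc _ _ _ _ (by simp; omega)]
    · subst h
      rw [Function.update_self]
      simp only [face, Fin.contractNth, Fin.val_castSucc, lt_irrefl, if_false, if_true]
      rw [insertNth_castSucc _ _ _ _ (by simp), Fin.succ_castSucc, hp,
        insertNth_succ _ _ _ _ (by simp)]
    · have h1 : (i : ℕ) < k := h
      rw [Function.update_of_ne h.ne']
      simp only [face, Fin.contractNth, Fin.val_castSucc, if_neg h1.not_gt, if_neg h1.ne', b]
      rw [← Fin.succ_castSucc k, insertNth_succ _ _ _ _ (by simp; omega),
        insertNth_succ _ _ _ _ (by simp; omega)]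
  have h0 : ∀ l, (i.succ.castSucc.insertNth l j : Fin (n + 3) → ι) 0 = j 0 := fun l =>
    insertNth_castSucc _ _ _ 0 (by simp)
  have h1 : ∀ l, (i.succ.castSucc.insertNth l j : Fin (n + 3) → ι) (Fin.last (n + 2)) =
      j (Fin.last (n + 1)) := fun l =>
    insertNth_succ _ _ _ (Fin.last (n + 1)) (by simp; omega)
  change _ = _ * φ b
  rw [hb, φ.map_update_sum, Finset.mul_sum]
  refine Finset.sum_congr rfl fun l _ => ?_
  rw [h0, h1, ← hl]
  rfl

/-- A multilinear form as a linear function of its first argument. -/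
def consLinear {n : ℕ} (φ : Cochain B n) (c : Fin n → B) : B →ₗ[ℂ] ℂ where
  toFun x := φ (Fin.cons x c)
  map_add' x y := φ.cons_add c x y
  map_smul' r x := φ.cons_smul c r x

theorem sum_cons {R : Type*} [AddCommMonoid R] {n : ℕ} (F : (Fin (n + 1) → ι) → R) :
    ∑ j, F j = ∑ j : Fin n → ι, ∑ l : ι, F (Fin.cons l j) := by
  rw [← (Fin.consEquiv (fun _ => ι)).sum_comp, Fintype.sum_prod_type, Finset.sum_comm]
  rfl

theorem sum_snoc {R : Type*} [AddCommMonoid R] {n : ℕ} (F : (Fin (n + 1) → ι) → R) :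
    ∑ j, F j = ∑ j : Fin n → ι, ∑ l : ι, F (Fin.snoc j l) := by
  rw [← (Fin.snocEquiv (n := n) (fun _ => ι)).sum_comp F, Fintype.sum_prod_type, Finset.sum_comm]
  rfl

/-- The algebra of matrices `X` over `B` with `λ(X) K = K X`. -/
def covariantMatrices (lam : B ≃ₐ[ℂ] B) (K : Matrix ι ι ℂ) : Subalgebra ℂ (Matrix ι ι B) where
  carrier := {X | lam.mapMatrix X * K.map (algebraMap ℂ B) = K.map (algebraMap ℂ B) * X}
  mul_mem' {X Y} hX hY := by
    simp only [Set.mem_ofPred_eq] at hX hY ⊢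
    rw [map_mul, mul_assoc, hY, ← mul_assoc, hX, mul_assoc]
  add_mem' {X Y} hX hY := by
    simp only [Set.mem_ofPred_eq] at hX hY ⊢
    rw [map_add, add_mul, hX, hY, mul_add]
  algebraMap_mem' c := by
    simp only [Set.mem_ofPred_eq]
    rw [AlgEquiv.commutes, Algebra.commutes]

theorem mem_covariantMatrices {lam : B ≃ₐ[ℂ] B} {K : Matrix ι ι ℂ} {X : Matrix ι ι B} :
    X ∈ covariantMatrices lam K ↔
      X.map lam * K.map (algebraMap ℂ B) = K.map (algebraMap ℂ B) * X := Iff.rfl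

/-- The weight K sits between the last and the first matrix. The relation λ(X)K = KX for the last
one moves it to the other side of K, where λ is gone. -/
theorem traceForm_cycDual {lam : B ≃ₐ[ℂ] B} {K : Matrix ι ι ℂ} {n : ℕ} (φ : Cochain B n)
    (a : Fin (n + 1) → Matrix ι ι B) (ha : a (Fin.last n) ∈ covariantMatrices lam K) :
    traceForm K (cycDual lam φ) a = traceForm K φ (cyc id a) := by
  rw [traceForm_apply, traceForm_apply]
  refine (sum_snoc _).trans (Eq.trans ?_ (sum_cons _).symm)
  refine Finset.sum_congr rfl fun j _ => ?_
  let L := consLinear φ fun i : Fin n => a i.castSucc (j i.castSucc) (j i.succ)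
  have hl : ∀ s : ι, cycDual lam φ (fun i => a i
      ((Fin.snoc j s : Fin (n + 2) → ι) i.castSucc) ((Fin.snoc j s : Fin (n + 2) → ι) i.succ)) =
      L (lam (a (Fin.last n) (j (Fin.last n)) s)) := by
    intro s
    change φ _ = φ _
    congr 1
    funext i
    refine Fin.cases ?_ (fun i => ?_) i
    · simp [cyc]
    · simp [cyc, ← Fin.castSucc_succ]
  have hr : ∀ r : ι, φ (fun i => (cyc id a) i
      ((Fin.cons r j : Fin (n + 2) → ι) i.castSucc) ((Fin.cons r j : Fin (n + 2) → ι) i.succ)) =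
      L (a (Fin.last n) r (j 0)) := by
    intro r
    change φ _ = φ _
    congr 1
    funext i
    refine Fin.cases ?_ (fun i => ?_) i
    · simp [cyc]
    · simp [cyc]
  have h0 : ∀ s, (Fin.snoc j s : Fin (n + 2) → ι) 0 = j 0 := fun s =>
    Fin.snoc_castSucc (α := fun _ => ι) s j (0 : Fin (n + 1))
  have h1 : ∀ r, (Fin.cons r j : Fin (n + 2) → ι) (Fin.last (n + 1)) = j (Fin.last n) := fun r => by
    rw [← Fin.succ_last, Fin.cons_succ]
  simp only [hl, hr, h0, h1, Fin.snoc_last, Fin.cons_zero]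
  have h2 := congrArg L (congrFun (congrFun (mem_covariantMatrices.mp ha) (j (Fin.last n))) (j 0))
  simp only [Matrix.mul_apply, map_sum, Matrix.map_apply, ← Algebra.smul_def, ← Algebra.commutes,
    map_smul, smul_eq_mul] at h2
  exact h2

theorem traceForm_extraDual (K : Matrix ι ι ℂ) {n : ℕ} (φ : Cochain B (n + 1))
    (a : Fin (n + 1) → Matrix ι ι B) :
    traceForm K (extraDual φ) a = traceForm K φ (Fin.cons 1 a) := by
  rw [traceForm_apply, traceForm_apply, sum_cons (n := n + 2)]
  refine Finset.sum_congr rfl fun j _ => ?_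
  let L := consLinear φ fun i : Fin (n + 1) => a i (j i.castSucc) (j i.succ)
  have hr : ∀ r : ι, φ (fun i => (Fin.cons 1 a : Fin (n + 2) → Matrix ι ι B) i
      ((Fin.cons r j : Fin (n + 3) → ι) i.castSucc) ((Fin.cons r j : Fin (n + 3) → ι) i.succ)) =
      if r = j 0 then L 1 else 0 := by
    intro r
    have : (if r = j 0 then L 1 else 0) = L ((1 : Matrix ι ι B) r (j 0)) := by
      rw [Matrix.one_apply]
      split_ifs <;> simp
    rw [this]
    change φ _ = φ _
    congr 1
    funext i
    refine Fin.cases ?_ (fun i => ?_) i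
    · simp
    · simp
  have h1 : ∀ r, (Fin.cons r j : Fin (n + 3) → ι) (Fin.last (n + 2)) = j (Fin.last (n + 1)) :=
    fun r => by rw [← Fin.succ_last, Fin.cons_succ]
  simp only [hr, h1, Fin.cons_zero, mul_ite, mul_zero, Finset.sum_ite_eq', Finset.mem_univ,
    if_true]
  rfl

/-- The restriction of `traceForm` to the covariant matrices. -/
def covariantForm (lam : B ≃ₐ[ℂ] B) (K : Matrix ι ι ℂ) {n : ℕ} :
    Cochain B n →ₗ[ℂ] Cochain (covariantMatrices lam K) n :=
  MultilinearMap.compLinearMapₗ (fun _ => (covariantMatrices lam K).val.toLinearMap) ∘ₗ traceForm K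

variable {lam : B ≃ₐ[ℂ] B} {K : Matrix ι ι ℂ}

theorem covariantForm_apply {n : ℕ} (φ : Cochain B n)
    (a : Fin (n + 1) → covariantMatrices lam K) :
    covariantForm lam K φ a = traceForm K φ (fun i => (a i : Matrix ι ι B)) := rfl

theorem covariantForm_faceDual {n : ℕ} (i : Fin (n + 1)) (φ : Cochain B n) :
    covariantForm lam K (faceDual i φ) = faceDual i (covariantForm lam K φ) := by
  ext a
  rw [covariantForm_apply, traceForm_faceDual]
  change _ = traceForm K φ _
  congr 1
  funext k
  simp only [face, Fin.contractNth]
  split_ifs <;> rfl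

theorem covariantForm_cycDual {n : ℕ} (φ : Cochain B n) :
    covariantForm lam K (cycDual lam φ) = cycDual .refl (covariantForm lam K φ) := by
  ext a
  rw [covariantForm_apply, traceForm_cycDual _ _ (a (Fin.last n)).2]
  change _ = traceForm K φ _
  congr 1
  funext k
  refine Fin.cases ?_ (fun k => ?_) k <;> rfl

theorem covariantForm_extraDual {n : ℕ} (φ : Cochain B (n + 1)) :
    covariantForm lam K (extraDual φ) = extraDual (covariantForm lam K φ) := by
  ext a
  rw [covariantForm_apply, traceForm_extraDual]
  change _ = traceForm K φ _
  congr 1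
  funext k
  refine Fin.cases ?_ (fun k => ?_) k <;> rfl

/-- With this factorisation, compatibility with faces and rotation is all that b requires. -/
theorem lastFaceDual_eq_cycDual_faceDual {A : Type*} [Ring A] [Algebra ℂ A] (lam : A ≃ₐ[ℂ] A)
    {n : ℕ} (φ : Cochain A n) : lastFaceDual lam φ = cycDual lam (faceDual 0 φ) := by
  ext a
  change φ _ = φ _
  rw [lastFace_eq_face_cyc]

theorem covariantForm_bDual {n : ℕ} (φ : Cochain B n) :
    covariantForm lam K (bDual lam φ) = bDual .refl (covariantForm lam K φ) := by
  simp only [bDual, LinearMap.add_apply, LinearMap.sum_apply, LinearMap.smul_apply, map_add,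
    map_sum, map_smul, lastFaceDual_eq_cycDual_faceDual, covariantForm_cycDual,
    covariantForm_faceDual]

theorem covariantForm_BDual {n : ℕ} (φ : Cochain B (n + 1)) :
    covariantForm lam K (BDual lam φ) = BDual .refl (covariantForm lam K φ) := by
  have hpow : ∀ (j : ℕ) (φ : Cochain B n), covariantForm lam K ((cycDual lam ^ j) φ) =
      (cycDual .refl ^ j) (covariantForm lam K φ) := by
    intro j
    induction j with
    | zero => intro φ; rfl
    | succ j ih =>
      intro φ
      rw [pow_succ, pow_succ, Module.End.mul_apply, Module.End.mul_apply, ih,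
        covariantForm_cycDual]
  simp only [BDual, normDual, LinearMap.comp_apply, LinearMap.sub_apply, LinearMap.id_apply,
    LinearMap.sum_apply, LinearMap.smul_apply, map_sub, map_sum, map_smul, hpow,
    covariantForm_cycDual, covariantForm_extraDual]

theorem covariantForm_totalDiff (ψ : ∀ m, Cochain B m) (m : ℕ) :
    covariantForm lam K (totalDiff lam ψ m) =
      totalDiff .refl (fun m => covariantForm lam K (ψ m)) m := by
  cases m with
  | zero => exact covariantForm_BDual (ψ 1)
  | succ m =>
    change covariantForm lam K (bDual lam (ψ m) + BDual lam (ψ (m + 2))) = _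
    rw [map_add, covariantForm_bDual, covariantForm_BDual]
    rfl

theorem chernTerm_covariantForm (i : ℕ) (ψ : Cochain B (2 * i)) (p : covariantMatrices lam K) :
    chernTerm i (covariantForm lam K ψ) p = chernTerm i (traceForm K ψ) (p : Matrix ι ι B) := by
  have h1 : (fun k => (((Fin.cons 1 fun _ => p : Fin (2 * i + 1) → covariantMatrices lam K) k :
      covariantMatrices lam K) : Matrix ι ι B)) = Fin.cons 1 fun _ => (p : Matrix ι ι B) := by
    funext k
    refine Fin.cases ?_ (fun k => ?_) k <;> rfl
  have h2 : (fun k => ((cyc id (Fin.cons 1 fun _ => p : Fin (2 * i + 1) →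
      covariantMatrices lam K) k : covariantMatrices lam K) : Matrix ι ι B)) =
      cyc id (Fin.cons 1 fun _ => (p : Matrix ι ι B)) := by
    rw [← h1]
    funext k
    refine Fin.cases ?_ (fun k => ?_) k <;> rfl
  simp only [chernTerm, covariantForm_apply, h1, h2]

theorem traceForm_submatrix (K : Matrix ι ι ℂ) (e : κ ≃ ι) {n : ℕ} (φ : Cochain B n)
    (a : Fin (n + 1) → Matrix ι ι B) :
    traceForm (K.submatrix e e) φ (fun i => (a i).submatrix e e) = traceForm K φ a := by
  rw [traceForm_apply, traceForm_apply]
  exact Fintype.sum_equiv (Equiv.arrowCongr (Equiv.refl _) e) _ _ fun j => rfl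

/-- An index path that changes block meets an off-diagonal zero, and multilinearity kills its term;
the others stay in one block. -/
theorem traceForm_fromBlocks (K : Matrix ι ι ℂ) (K' : Matrix κ κ ℂ) {n : ℕ} (φ : Cochain B n)
    (a : Fin (n + 1) → Matrix ι ι B) (b : Fin (n + 1) → Matrix κ κ B) :
    traceForm (Matrix.fromBlocks K 0 0 K') φ (fun i => Matrix.fromBlocks (a i) 0 0 (b i)) =
      traceForm K φ a + traceForm K' φ b := by
  simp only [traceForm_apply]
  let g : (Fin (n + 2) → ι) ⊕ (Fin (n + 2) → κ) → Fin (n + 2) → ι ⊕ κ :=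
    Sum.elim (fun j i => Sum.inl (j i)) (fun j i => Sum.inr (j i))
  let F : (Fin (n + 2) → ι) ⊕ (Fin (n + 2) → κ) → ℂ := Sum.elim
    (fun j => K (j (Fin.last (n + 1))) (j 0) * φ fun i => a i (j i.castSucc) (j i.succ))
    (fun j => K' (j (Fin.last (n + 1))) (j 0) * φ fun i => b i (j i.castSucc) (j i.succ))
  refine Eq.trans (Eq.symm ?_) (Fintype.sum_sum_type F)
  refine Fintype.sum_of_injective g ?_ _ _ ?_ ?_
  · rintro (j | j) (j' | j') h
    · exact congrArg Sum.inl (funext fun i => Sum.inl_injective (congrFun h i))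
    · exact absurd (congrFun h 0) (by simp [g])
    · exact absurd (congrFun h 0) (by simp [g])
    · exact congrArg Sum.inr (funext fun i => Sum.inr_injective (congrFun h i))
  · intro J hJ
    by_cases hside : ∀ i : Fin (n + 1), (J i.castSucc).isLeft = (J i.succ).isLeft
    · exfalso
      apply hJ
      have hall : ∀ i, (J i).isLeft = (J 0).isLeft := fun i => by
        induction i using Fin.induction with
        | zero => rfl
        | succ i ih => rw [← hside, ih]
      rcases h0 : (J 0).isLeft with _ | _
      · simp only [h0, Sum.isLeft_eq_false, Sum.isRight_iff] at hall
        choose j hj using hall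
        exact ⟨Sum.inr j, funext fun i => (hj i).symm⟩
      · simp only [h0, Sum.isLeft_iff] at hall
        choose j hj using hall
        exact ⟨Sum.inl j, funext fun i => (hj i).symm⟩
    · push Not at hside
      obtain ⟨i, hi⟩ := hside
      rw [φ.map_coord_zero i, mul_zero]
      rcases h1 : J i.castSucc with x | x <;> rcases h2 : J i.succ with y | y <;> simp_all
  · rintro (j | j) <;> rfl

theorem chernTerm_submatrix (K : Matrix ι ι ℂ) (e : κ ≃ ι) (i : ℕ) (ψ : Cochain B (2 * i))
    (p : Matrix ι ι B) :
    chernTerm i (traceForm (K.submatrix e e) ψ) (p.submatrix e e) =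
      chernTerm i (traceForm K ψ) p := by
  have h1 : (Fin.cons 1 fun _ => p.submatrix e e : Fin (2 * i + 1) → Matrix κ κ B) =
      fun k => ((Fin.cons 1 fun _ => p : Fin (2 * i + 1) → Matrix ι ι B) k).submatrix e e := by
    funext k
    refine Fin.cases ?_ (fun k => ?_) k
    · simp
    · rfl
  have h2 : cyc id (Fin.cons 1 fun _ => p.submatrix e e : Fin (2 * i + 1) → Matrix κ κ B) =
      fun k => (cyc id (Fin.cons 1 fun _ => p : Fin (2 * i + 1) → Matrix ι ι B) k).submatrix e e := by
    rw [h1]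
    funext k
    refine Fin.cases ?_ (fun k => ?_) k <;> rfl
  rw [chernTerm, chernTerm, h2, h1, traceForm_submatrix K e ψ (Fin.cons 1 fun _ => p),
    traceForm_submatrix K e ψ (cyc id _), traceForm_submatrix K e ψ fun _ => p]

theorem chernTerm_fromBlocks (K : Matrix ι ι ℂ) (K' : Matrix κ κ ℂ) (i : ℕ)
    (ψ : Cochain B (2 * i)) (p : Matrix ι ι B) (q : Matrix κ κ B) :
    chernTerm i (traceForm (Matrix.fromBlocks K 0 0 K') ψ) (Matrix.fromBlocks p 0 0 q) =
      chernTerm i (traceForm K ψ) p + chernTerm i (traceForm K' ψ) q := by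
  have h1 : (Fin.cons 1 fun _ => Matrix.fromBlocks p 0 0 q :
      Fin (2 * i + 1) → Matrix (ι ⊕ κ) (ι ⊕ κ) B) =
      fun k => Matrix.fromBlocks ((Fin.cons 1 fun _ => p : Fin (2 * i + 1) → Matrix ι ι B) k) 0 0
        ((Fin.cons 1 fun _ => q : Fin (2 * i + 1) → Matrix κ κ B) k) := by
    funext k
    refine Fin.cases ?_ (fun k => ?_) k
    · simp
    · rfl
  have h2 : cyc id (Fin.cons 1 fun _ => Matrix.fromBlocks p 0 0 q :
      Fin (2 * i + 1) → Matrix (ι ⊕ κ) (ι ⊕ κ) B) =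
      fun k => Matrix.fromBlocks
        (cyc id (Fin.cons 1 fun _ => p : Fin (2 * i + 1) → Matrix ι ι B) k) 0 0
        (cyc id (Fin.cons 1 fun _ => q : Fin (2 * i + 1) → Matrix κ κ B) k) := by
    rw [h1]
    funext k
    refine Fin.cases ?_ (fun k => ?_) k <;> rfl
  rw [chernTerm, chernTerm, chernTerm, h2, h1,
    traceForm_fromBlocks K K' ψ (Fin.cons 1 fun _ => p) (Fin.cons 1 fun _ => q),
    traceForm_fromBlocks K K' ψ (cyc id _) (cyc id _), traceForm_fromBlocks K K' ψ (fun _ => p) fun _ => q]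
  ring

theorem chernTerm_apply_zero {A : Type*} [Ring A] [Algebra ℂ A] (i : ℕ)
    (ψ : Cochain A (2 * i)) : chernTerm i ψ 0 = 0 := by
  cases i with
  | zero => exact (chernTerm_zero ψ 0).trans (ψ.map_coord_zero 0 rfl)
  | succ i =>
    refine (chernTerm_succ i ψ 0).trans ?_
    rw [MultilinearMap.map_coord_zero _ 0 rfl, MultilinearMap.map_coord_zero _ 0 rfl]
    ring

end TraceForm

/-! ### Covariance obtained from group-like elements. -/

section GroupLike

variable {U B : Type*} [Ring U] [HopfAlgebra ℂ U] [StarRing U] [StarModule ℂ U]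
  [IsHopfStarAlgebra U] [Ring B] [Algebra ℂ B] [StarRing B] [StarModule ℂ B]

/-- On group-like elements S² is the identity, so every power of S in the definitions reduces to S
or to nothing. -/
theorem antipodeInv_of_isGroupLikeElem {k : U} (hk : IsGroupLikeElem ℂ k) :
    antipodeInv k = antipode ℂ k := by
  have h := antipodeInv_antipode (antipode ℂ k)
  rwa [hk.antipode_antipode] at h

theorem isGroupLikeElem_star {k : U} (hk : IsGroupLikeElem ℂ k) : IsGroupLikeElem ℂ (star k) where
  counit_eq_one := by rw [IsHopfStarAlgebra.counit_star, hk.counit_eq_one, star_one]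
  comul_eq_tmul_self := by
    rw [IsHopfStarAlgebra.comul_star, hk.comul_eq_tmul_self, TensorProduct.star_tmul]

theorem repMatrix_mul {m : ℕ} (ρ : Uᵐᵒᵖ →⋆ₐ[ℂ] Matrix (Fin m) (Fin m) ℂ) (f g : U) :
    repMatrix B ρ (f * g) = repMatrix B ρ g * repMatrix B ρ f := by
  change (ρ (MulOpposite.op (f * g))).map (algebraMap ℂ B) = _
  rw [MulOpposite.op_mul, map_mul, Matrix.map_mul]
  rfl

theorem repMatrix_one {m : ℕ} (ρ : Uᵐᵒᵖ →⋆ₐ[ℂ] Matrix (Fin m) (Fin m) ℂ) :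
    repMatrix B ρ (1 : U) = 1 := by
  change (ρ (MulOpposite.op 1)).map (algebraMap ℂ B) = _
  rw [MulOpposite.op_one, map_one, Matrix.map_one _ (map_zero _) (map_one _)]

theorem repMatrix_mul_antipode {m : ℕ} (ρ : Uᵐᵒᵖ →⋆ₐ[ℂ] Matrix (Fin m) (Fin m) ℂ) {k : U}
    (hk : IsGroupLikeElem ℂ k) : repMatrix B ρ k * repMatrix B ρ (antipode ℂ k) = 1 := by
  rw [← repMatrix_mul, hk.antipode_mul_cancel, repMatrix_one]

theorem repMatrix_antipode_mul {m : ℕ} (ρ : Uᵐᵒᵖ →⋆ₐ[ℂ] Matrix (Fin m) (Fin m) ℂ) {k : U}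
    (hk : IsGroupLikeElem ℂ k) : repMatrix B ρ (antipode ℂ k) * repMatrix B ρ k = 1 := by
  rw [← repMatrix_mul, hk.mul_antipode_cancel, repMatrix_one]

theorem adR_of_isGroupLikeElem (M : ModuleStarAlgebra U B) {m : ℕ}
    (ρ : Uᵐᵒᵖ →⋆ₐ[ℂ] Matrix (Fin m) (Fin m) ℂ) {k : U} (hk : IsGroupLikeElem ℂ k)
    (X : Matrix (Fin m) (Fin m) B) :
    adR M ρ k X = repMatrix B ρ (antipode ℂ k) * (X.map (M.act k) * repMatrix B ρ k) := by
  have h : antipodeInv (antipode ℂ k) = k := antipodeInv_antipode k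
  rw [adR, hk.comul_eq_tmul_self, LinearMap.lTensor_tmul, hk.comul_eq_tmul_self]
  simp only [adRTensor, LinearMap.comp_apply, TensorProduct.map_tmul, LinearMap.mul'_apply,
    antipodeInv_of_isGroupLikeElem hk, h]
  rfl

theorem piRep_of_isGroupLikeElem (M : ModuleStarAlgebra U B) {m : ℕ}
    (ρ : Uᵐᵒᵖ →⋆ₐ[ℂ] Matrix (Fin m) (Fin m) ℂ) {k : U} (hk : IsGroupLikeElem ℂ k)
    (b : Fin m → B) :
    piRep M ρ k b = (repMatrix B ρ k).mulVec (fun i => M.act (antipode ℂ k) (b i)) := by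
  rw [piRep, hk.comul_eq_tmul_self, TensorProduct.lift.tmul, LinearMap.mk₂_apply,
    antipodeInv_of_isGroupLikeElem hk]

theorem InvariantProjection.map_act_mul {M : ModuleStarAlgebra U B} {σ : B ≃ₐ[ℂ] B}
    (P : InvariantProjection M σ) {k : U} (hk : IsGroupLikeElem ℂ k) :
    P.mat.map (M.act k) * repMatrix B P.rep k = repMatrix B P.rep k * P.mat := by
  have h := P.invariant k
  rw [adR_of_isGroupLikeElem M _ hk, hk.counit_eq_one, one_smul] at h
  rw [← congrArg (repMatrix B P.rep k * ·) h, ← mul_assoc (repMatrix B P.rep k),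
    repMatrix_mul_antipode _ hk, one_mul]

theorem map_act_mul_of_intertwines (M : ModuleStarAlgebra U B) {m n : ℕ}
    (ρ₁ : Uᵐᵒᵖ →⋆ₐ[ℂ] Matrix (Fin m) (Fin m) ℂ) (ρ₂ : Uᵐᵒᵖ →⋆ₐ[ℂ] Matrix (Fin n) (Fin n) ℂ)
    {V : Matrix (Fin n) (Fin m) B}
    (hV : ∀ (f : U) (b : Fin m → B), piRep M ρ₂ f (V.mulVec b) = V.mulVec (piRep M ρ₁ f b))
    {k : U} (hk : IsGroupLikeElem ℂ k) :
    V.map (M.act k) * repMatrix B ρ₁ k = repMatrix B ρ₂ k * V := by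
  have h : repMatrix B ρ₂ (antipode ℂ k) * V.map (M.act k) =
      V * repMatrix B ρ₁ (antipode ℂ k) := by
    ext i j
    -- The intertwining relation is tested at S(k), since the action involves S⁻¹, and on basis
    -- vectors, which k fixes because k ▷ 1 = 1.
    have h1 := congrFun (hV (antipode ℂ k) (Pi.single j 1)) i
    rw [piRep_of_isGroupLikeElem M _ hk.antipode, piRep_of_isGroupLikeElem M _ hk.antipode,
      hk.antipode_antipode] at h1
    have h2 : (fun i => M.act k ((Pi.single j 1 : Fin m → B) i)) = Pi.single j 1 := by
      funext i
      by_cases hi : i = j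
      · subst hi
        simp [M.act_one, hk.counit_eq_one]
      · simp [hi]
    have h3 : ∀ {l : ℕ} (X : Matrix (Fin l) (Fin m) B),
        X.mulVec (Pi.single j 1) = fun i => X i j := fun X => by
      rw [Matrix.mulVec_single_one]
      rfl
    rw [h2, h3, h3] at h1
    exact h1
  calc V.map (M.act k) * repMatrix B ρ₁ k
      = repMatrix B ρ₂ k * (repMatrix B ρ₂ (antipode ℂ k) * V.map (M.act k)) *
          repMatrix B ρ₁ k := by
        rw [← Matrix.mul_assoc, repMatrix_mul_antipode _ hk, Matrix.one_mul]
    _ = repMatrix B ρ₂ k * V := by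
        rw [h, Matrix.mul_assoc, Matrix.mul_assoc, repMatrix_antipode_mul _ hk, Matrix.mul_one]

theorem dagger_mul (σ : B ≃ₐ[ℂ] B) {m n l : ℕ} (X : Matrix (Fin m) (Fin n) B)
    (Y : Matrix (Fin n) (Fin l) B) : dagger σ (X * Y) = dagger σ Y * dagger σ X := by
  rw [dagger, Matrix.map_mul, Matrix.conjTranspose_mul]
  rfl

theorem dagger_repMatrix (σ : B ≃ₐ[ℂ] B) {m : ℕ} (ρ : Uᵐᵒᵖ →⋆ₐ[ℂ] Matrix (Fin m) (Fin m) ℂ)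
    (g : U) : dagger σ (repMatrix B ρ g) = repMatrix B ρ (star g) := by
  ext i j
  change star (σ (algebraMap ℂ B (ρ (MulOpposite.op g) j i))) =
    algebraMap ℂ B (ρ (MulOpposite.op (star g)) i j)
  rw [AlgEquiv.commutes, MulOpposite.op_star, map_star, ← algebraMap_star_comm]
  rfl

/-- Apply † to the covariance of V at the group-like element S(k*). There S² is trivial, so σ
commutes with the action, and the star turns S(k*) into S(k) in the representation and into k in the
action. -/
theorem dagger_map_act_mul_of_intertwines (M : ModuleStarAlgebra U B) (σ : B ≃ₐ[ℂ] B)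
    (hσ_act : ∀ (f : U) (b : B), σ (M.act f b) = M.act (antipode ℂ (antipode ℂ f)) (σ b))
    {m n : ℕ} (ρ₁ : Uᵐᵒᵖ →⋆ₐ[ℂ] Matrix (Fin m) (Fin m) ℂ)
    (ρ₂ : Uᵐᵒᵖ →⋆ₐ[ℂ] Matrix (Fin n) (Fin n) ℂ) {V : Matrix (Fin n) (Fin m) B}
    (hV : ∀ (f : U) (b : Fin m → B), piRep M ρ₂ f (V.mulVec b) = V.mulVec (piRep M ρ₁ f b))
    {k : U} (hk : IsGroupLikeElem ℂ k) :
    (dagger σ V).map (M.act k) * repMatrix B ρ₂ k = repMatrix B ρ₁ k * dagger σ V := by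
  have hk' := isGroupLikeElem_star hk
  have h1 : dagger σ (V.map (M.act (antipode ℂ (star k)))) = (dagger σ V).map (M.act k) := by
    ext i j
    change star (σ (M.act (antipode ℂ (star k)) (V j i))) = M.act k (star (σ (V j i)))
    rw [hσ_act, hk'.antipode_antipode, M.star_act, hk'.antipode_antipode, star_star]
  have h2 := congrArg (dagger σ) (map_act_mul_of_intertwines M ρ₁ ρ₂ hV hk'.antipode)
  have h3 : star (antipode ℂ (star k)) = antipode ℂ k := antipodeInv_of_isGroupLikeElem hk
  rw [dagger_mul, dagger_mul, dagger_repMatrix, dagger_repMatrix, h1, h3] at h2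
  calc (dagger σ V).map (M.act k) * repMatrix B ρ₂ k
      = repMatrix B ρ₁ k * (repMatrix B ρ₁ (antipode ℂ k) * (dagger σ V).map (M.act k)) *
          repMatrix B ρ₂ k := by
        rw [← Matrix.mul_assoc, repMatrix_mul_antipode _ hk, Matrix.one_mul]
    _ = repMatrix B ρ₁ k * dagger σ V := by
        rw [h2, Matrix.mul_assoc, Matrix.mul_assoc, repMatrix_antipode_mul _ hk, Matrix.mul_one]

end GroupLike

/-! ### Invariance results for covariant idempotent matrices. -/

section Covariant

variable {B : Type*} [Ring B] [Algebra ℂ B] {ι κ : Type*} [Fintype ι] [DecidableEq ι]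
  [Fintype κ] [DecidableEq κ] {lam : B ≃ₐ[ℂ] B} {K : Matrix ι ι ℂ} {L : Matrix κ κ ℂ}

/-- In block matrices with weight K ⊕ L, p and q occupy complementary corners and are orthogonal,
while v and w become off-diagonal covariant elements. The zero blocks contribute nothing to the
trace. -/
theorem sum_chernTerm_eq_of_matrix_equiv {p : Matrix ι ι B} {q : Matrix κ κ B}
    {v : Matrix κ ι B} {w : Matrix ι κ B} (hp : p ∈ covariantMatrices lam K)
    (hq : q ∈ covariantMatrices lam L) (hpp : p * p = p) (hqq : q * q = q)
    (hv : v.map lam * K.map (algebraMap ℂ B) = L.map (algebraMap ℂ B) * v)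
    (hw : w.map lam * L.map (algebraMap ℂ B) = K.map (algebraMap ℂ B) * w)
    (hwv : w * v = p) (hvw : v * w = q)
    (ψ : ∀ m, Cochain B m) (hψ : totalDiff lam ψ = 0) {n : ℕ} (hn : ψ (2 * n + 2) = 0) :
    ∑ i ∈ Finset.range (n + 1), chernTerm i (traceForm K (ψ (2 * i))) p =
      ∑ i ∈ Finset.range (n + 1), chernTerm i (traceForm L (ψ (2 * i))) q := by
  let A := covariantMatrices lam (Matrix.fromBlocks K 0 0 L)
  have hK : (Matrix.fromBlocks K 0 0 L).map (algebraMap ℂ B) =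
      Matrix.fromBlocks (K.map (algebraMap ℂ B)) 0 0 (L.map (algebraMap ℂ B)) := by
    simp [Matrix.fromBlocks_map]
  rw [mem_covariantMatrices] at hp hq
  let p' : A := ⟨Matrix.fromBlocks p 0 0 0, by
    rw [mem_covariantMatrices, hK]
    simp [Matrix.fromBlocks_map, Matrix.fromBlocks_multiply, hp]⟩
  let q' : A := ⟨Matrix.fromBlocks 0 0 0 q, by
    rw [mem_covariantMatrices, hK]
    simp [Matrix.fromBlocks_map, Matrix.fromBlocks_multiply, hq]⟩
  let v' : A := ⟨Matrix.fromBlocks 0 0 v 0, by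
    rw [mem_covariantMatrices, hK]
    simp [Matrix.fromBlocks_map, Matrix.fromBlocks_multiply, hv]⟩
  let w' : A := ⟨Matrix.fromBlocks 0 w 0 0, by
    rw [mem_covariantMatrices, hK]
    simp [Matrix.fromBlocks_map, Matrix.fromBlocks_multiply, hw]⟩
  have h := sum_chernTerm_eq_of_equiv (p := p') (q := q') (v := v') (w := w')
    (Subtype.ext (by simp [p', Matrix.fromBlocks_multiply, hpp]))
    (Subtype.ext (by simp [q', Matrix.fromBlocks_multiply, hqq]))
    (Subtype.ext (by simp [p', q', Matrix.fromBlocks_multiply]))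
    (Subtype.ext (by simp [p', q', Matrix.fromBlocks_multiply]))
    (Subtype.ext (by simp [p', v', w', Matrix.fromBlocks_multiply, hwv]))
    (Subtype.ext (by simp [q', v', w', Matrix.fromBlocks_multiply, hvw]))
    (fun m => covariantForm lam (Matrix.fromBlocks K 0 0 L) (ψ m))
    (funext fun m => by rw [← covariantForm_totalDiff, hψ]; exact map_zero _)
    (n := n) (by rw [hn, map_zero])
  have hp' : ∀ i, chernTerm i (covariantForm lam (Matrix.fromBlocks K 0 0 L) (ψ (2 * i))) p' =
      chernTerm i (traceForm K (ψ (2 * i))) p := fun i => by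
    rw [chernTerm_covariantForm, chernTerm_fromBlocks, chernTerm_apply_zero, add_zero]
  have hq' : ∀ i, chernTerm i (covariantForm lam (Matrix.fromBlocks K 0 0 L) (ψ (2 * i))) q' =
      chernTerm i (traceForm L (ψ (2 * i))) q := fun i => by
    rw [chernTerm_covariantForm, chernTerm_fromBlocks, chernTerm_apply_zero, zero_add]
  simpa only [hp', hq'] using h

theorem sum_chernTerm_traceForm_totalDiff {p : Matrix ι ι B} (hp : p ∈ covariantMatrices lam K)
    (hpp : p * p = p) (φ : ∀ m, Cochain B m) {n : ℕ} (hn : φ (2 * n + 1) = 0) :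
    ∑ i ∈ Finset.range (n + 1), chernTerm i (traceForm K (totalDiff lam φ (2 * i))) p = 0 := by
  have h := sum_chernTerm_totalDiff (e := (⟨p, hp⟩ : covariantMatrices lam K))
    (Subtype.ext hpp) (fun m => covariantForm lam K (φ m)) n
  simp only [← covariantForm_totalDiff, chernTerm_covariantForm, hn, map_zero] at h
  rw [h]
  simp [chernTerm]

end Covariant

/-! ### Descent to cohomology and K-theory. -/

section Pairing

variable {U B : Type*} [Ring U] [HopfAlgebra ℂ U] [StarRing U] [StarModule ℂ U]
  [IsHopfStarAlgebra U] [Ring B] [Algebra ℂ B] [StarRing B] [StarModule ℂ B]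
  {M : ModuleStarAlgebra U B} {σ : B ≃ₐ[ℂ] B} {k : U} {lam : B ≃ₐ[ℂ] B}

theorem evalCochain_traceOf (k : U) (P : InvariantProjection M σ) {n : ℕ} (φ : Cochain B n) :
    evalCochain φ (traceOf k P n) =
      traceForm (P.rep (MulOpposite.op k)) φ (fun _ => P.mat) := by
  simp [evalCochain, traceOf, quantumTrace, traceForm_apply]

theorem evalCochain_chernComponent (k : U) (P : InvariantProjection M σ) (i : ℕ)
    (φ : Cochain B (2 * i)) :
    evalCochain φ (chernComponent k P i) =
      chernTerm i (traceForm (P.rep (MulOpposite.op k)) φ) P.mat := by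
  simp [evalCochain, chernComponent, traceOf, quantumTrace, traceForm_apply, chernTerm,
    chernCoeff]

/-- The evaluation of a family of cochains on the Chern character of an invariant projection. -/
def evalChern (k : U) (n : ℕ) (ψ : ∀ m, Cochain B m) (P : InvariantProjection M σ) : ℂ :=
  ∑ i ∈ Finset.range (n + 1), evalCochain (ψ (2 * i)) (chernComponent k P i)

theorem evalChern_eq (k : U) (n : ℕ) (ψ : ∀ m, Cochain B m) (P : InvariantProjection M σ) :
    evalChern k n ψ P = ∑ i ∈ Finset.range (n + 1),
      chernTerm i (traceForm (P.rep (MulOpposite.op k)) (ψ (2 * i))) P.mat := by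
  simp only [evalChern, evalCochain_chernComponent]

theorem InvariantProjection.mem_covariantMatrices (hk : IsGroupLikeElem ℂ k)
    (hlam : ∀ b, lam b = M.act k b) (P : InvariantProjection M σ) :
    P.mat ∈ covariantMatrices lam (P.rep (MulOpposite.op k)) := by
  have h : P.mat.map lam = P.mat.map (M.act k) := by
    ext i j
    exact hlam _
  rw [TwistedChern.mem_covariantMatrices, h]
  exact P.map_act_mul hk

theorem evalChern_eq_of_mvNEquiv
    (hσ_act : ∀ (f : U) (b : B), σ (M.act f b) = M.act (antipode ℂ (antipode ℂ f)) (σ b))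
    (hk : IsGroupLikeElem ℂ k) (hlam : ∀ b, lam b = M.act k b) {n : ℕ}
    {ψ : ∀ m, Cochain B m} (hψ : ψ ∈ totalCocycles lam (2 * n)) {P Q : InvariantProjection M σ}
    (h : MvNEquiv P Q) : evalChern k n ψ P = evalChern k n ψ Q := by
  obtain ⟨V, hVP, hVQ, hV⟩ := h
  have hmap : ∀ {l m : ℕ} (X : Matrix (Fin l) (Fin m) B), X.map lam = X.map (M.act k) := by
    intro l m X
    ext i j
    exact hlam _
  rw [evalChern_eq, evalChern_eq]
  refine sum_chernTerm_eq_of_matrix_equiv (lam := lam) (P.mem_covariantMatrices hk hlam)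
    (Q.mem_covariantMatrices hk hlam) P.idem Q.idem (v := V) (w := dagger σ V) ?_ ?_ hVP hVQ ψ
    -- Degree 2n+2 exceeds the total degree of ψ, so nothing sits above the top transgression.
    hψ.2 (hψ.1.1 _ (by omega))
  · rw [hmap]
    exact map_act_mul_of_intertwines M P.rep Q.rep hV hk
  · rw [hmap]
    exact dagger_map_act_mul_of_intertwines M σ hσ_act P.rep Q.rep hV hk

theorem evalChern_directSum (k : U) (n : ℕ) (ψ : ∀ m, Cochain B m)
    (P Q : InvariantProjection M σ) :
    evalChern k n ψ (P.directSum Q) = evalChern k n ψ P + evalChern k n ψ Q := by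
  simp only [evalChern_eq, ← Finset.sum_add_distrib, ← chernTerm_fromBlocks]
  refine Finset.sum_congr rfl fun i _ => ?_
  exact chernTerm_submatrix _ finSumFinEquiv.symm i _ _

theorem evalChern_totalDiff (hk : IsGroupLikeElem ℂ k) (hlam : ∀ b, lam b = M.act k b) {n : ℕ}
    {φ : ∀ m, Cochain B m} (hφ : φ ∈ totalCoboundaries lam (2 * n))
    (P : InvariantProjection M σ) : evalChern k n φ P = 0 := by
  cases n with
  | zero =>
    have h : φ = 0 := hφ
    simp [h, evalChern, evalCochain]
  | succ n =>
    obtain ⟨χ, hχ, rfl⟩ : ∃ χ ∈ totalCochains lam (2 * n + 1), totalDiff lam χ = φ := hφ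
    rw [evalChern_eq]
    exact sum_chernTerm_traceForm_totalDiff (P.mem_covariantMatrices hk hlam) P.idem χ
      (hχ.1 _ (by omega))

theorem evalChern_add (k : U) (n : ℕ) (ψ φ : ∀ m, Cochain B m) (P : InvariantProjection M σ) :
    evalChern k n (ψ + φ) P = evalChern k n ψ P + evalChern k n φ P := by
  simp only [evalChern_eq, Pi.add_apply, map_add, chernTerm_add, Finset.sum_add_distrib]

theorem evalChern_smul (k : U) (n : ℕ) (c : ℂ) (ψ : ∀ m, Cochain B m)
    (P : InvariantProjection M σ) : evalChern k n (c • ψ) P = c * evalChern k n ψ P := by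
  simp only [evalChern_eq, Pi.smul_apply, map_smul, chernTerm_smul, Finset.mul_sum]

/-- The evaluation of a cocycle on the Chern character, as a homomorphism on `K₀`. -/
def k0Eval (hσ_act : ∀ (f : U) (b : B), σ (M.act f b) = M.act (antipode ℂ (antipode ℂ f)) (σ b))
    (hk : IsGroupLikeElem ℂ k) (hlam : ∀ b, lam b = M.act k b) (n : ℕ)
    (ψ : totalCocycles lam (2 * n)) : K0 M σ →+ ℂ :=
  QuotientAddGroup.lift (k0Relations M σ) (FreeAbelianGroup.lift (evalChern k n ψ.1)) (by
    rw [k0Relations, AddSubgroup.closure_le]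
    rintro x (⟨P, Q, h, rfl⟩ | ⟨P, Q, rfl⟩)
    · simp [AddMonoidHom.mem_ker, evalChern_eq_of_mvNEquiv hσ_act hk hlam ψ.2 h]
    · simp [AddMonoidHom.mem_ker, evalChern_directSum])

theorem k0Eval_of (hσ_act : ∀ (f : U) (b : B),
      σ (M.act f b) = M.act (antipode ℂ (antipode ℂ f)) (σ b))
    (hk : IsGroupLikeElem ℂ k) (hlam : ∀ b, lam b = M.act k b) (n : ℕ)
    (ψ : totalCocycles lam (2 * n)) (P : InvariantProjection M σ) :
    k0Eval hσ_act hk hlam n ψ (K0.of P) = evalChern k n ψ.1 P :=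
  FreeAbelianGroup.lift_apply_of _ _

theorem k0_hom_ext {f g : K0 M σ →+ ℂ} (h : ∀ P, f (K0.of P) = g (K0.of P)) : f = g :=
  QuotientAddGroup.addMonoidHom_ext _ (FreeAbelianGroup.lift_ext _ _ h)

/-- The pairing of twisted cyclic cohomology with equivariant K-theory. -/
def chernPairing (hσ_act : ∀ (f : U) (b : B),
      σ (M.act f b) = M.act (antipode ℂ (antipode ℂ f)) (σ b))
    (hk : IsGroupLikeElem ℂ k) (hlam : ∀ b, lam b = M.act k b) (n : ℕ) :
    HC lam (2 * n) →ₗ[ℂ] (K0 M σ →+ ℂ) :=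
  Submodule.liftQ _
    { toFun := k0Eval hσ_act hk hlam n
      map_add' := fun ψ φ => k0_hom_ext fun P => by
        rw [AddMonoidHom.add_apply, k0Eval_of, k0Eval_of, k0Eval_of]
        exact evalChern_add k n ψ.1 φ.1 P
      map_smul' := fun c ψ => k0_hom_ext fun P => by
        change _ = c • k0Eval hσ_act hk hlam n ψ (K0.of P)
        rw [k0Eval_of, k0Eval_of]
        exact evalChern_smul k n c ψ.1 P }
    (fun ψ hψ => k0_hom_ext fun P => by
      change k0Eval hσ_act hk hlam n ψ (K0.of P) = 0
      rw [k0Eval_of]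
      exact evalChern_totalDiff hk hlam hψ P)

/-- In even degree cyclicity means Φ is invariant under the twisted rotation, so the trace takes
equal values on the two tuples of the correction term. -/
theorem evalChern_single (hk : IsGroupLikeElem ℂ k) (hlam : ∀ b, lam b = M.act k b) (n : ℕ)
    (Φ : cyclicCocycles lam (2 * n)) (P : InvariantProjection M σ) :
    evalChern k n (Pi.single (2 * n) (Φ : Cochain B (2 * n))) P =
      chernCoeff n * evalCochain Φ.1 (traceOf k P (2 * n)) := by
  obtain ⟨Φ, hΦ, -⟩ := Φ
  have hcyc : Φ - (-1 : ℂ) ^ (2 * n) • cycDual lam Φ = 0 := hΦ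
  rw [(even_two_mul n).neg_one_pow, one_smul, sub_eq_zero] at hcyc
  rw [evalChern_eq, Finset.sum_eq_single_of_mem n (by simp), Pi.single_eq_same, chernTerm,
    evalCochain_traceOf]
  -- The last entry is 1 when n = 0 and P otherwise; both are covariant.
  · have hlast : (Fin.cons 1 fun _ => P.mat : Fin (2 * n + 1) → _) (Fin.last (2 * n)) ∈
        covariantMatrices lam (P.rep (MulOpposite.op k)) := by
      refine Fin.cases ?_ (fun _ => ?_) (Fin.last (2 * n))
      · exact one_mem _
      · exact P.mem_covariantMatrices hk hlam
    rw [← traceForm_cycDual Φ _ hlast, ← hcyc]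
    ring
  · intro i _ hi
    rw [Pi.single_eq_of_ne (by omega), map_zero]
    simp [chernTerm]

end Pairing

end TwistedChern

end

theorem mainTheorem2 {U B : Type*} [Ring U] [HopfAlgebra ℂ U] [StarRing U] [StarModule ℂ U]
    [TwistedChern.IsHopfStarAlgebra U]
    [Ring B] [Algebra ℂ B] [StarRing B] [StarModule ℂ B]
    (M : TwistedChern.ModuleStarAlgebra U B)
    (σ : B ≃ₐ[ℂ] B) (hσ_star : ∀ b, star (σ b) = σ.symm (star b))
    (hσ_act : ∀ (f : U) (b : B),
      σ (M.act f b) = M.act (HopfAlgebra.antipode ℂ (HopfAlgebra.antipode ℂ f)) (σ b))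
    (k : U) (hk : IsGroupLikeElem ℂ k)
    (lam : B ≃ₐ[ℂ] B) (hlam : ∀ b, lam b = M.act k b) (n : ℕ) :
    ∃ pairing : TwistedChern.HC lam (2 * n) →ₗ[ℂ] (TwistedChern.K0 M σ →+ ℂ),
      (∀ (ψ : TwistedChern.totalCocycles lam (2 * n)) (P : TwistedChern.InvariantProjection M σ),
        pairing (TwistedChern.HC.of ψ) (TwistedChern.K0.of P) =
          ∑ i ∈ Finset.range (n + 1),
            TwistedChern.evalCochain (ψ.1 (2 * i)) (TwistedChern.chernComponent k P i)) ∧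
      ∀ (Φ : TwistedChern.cyclicCocycles lam (2 * n)) (P : TwistedChern.InvariantProjection M σ),
        pairing (TwistedChern.cyclicClass Φ) (TwistedChern.K0.of P) =
          (-1 : ℂ) ^ n * ((Nat.factorial (2 * n) : ℂ) / (Nat.factorial n : ℂ)) *
            TwistedChern.evalCochain Φ.1 (TwistedChern.traceOf k P (2 * n)) :=
  ⟨TwistedChern.chernPairing hσ_act hk hlam n,
    fun ψ P => TwistedChern.k0Eval_of hσ_act hk hlam n ψ P,
    fun Φ P => (TwistedChern.k0Eval_of hσ_act hk hlam n _ P).trans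
      (TwistedChern.evalChern_single hk hlam n Φ P)⟩
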